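/- For positive integers $n,p,q$ with $1 \le q \le \binom p2$, let $f(n,p,q)$ denote the minimum number of colours in an edge-colouring of the complete graph $K_n$ in which the edges of every copy of $K_p$ receive at least $q$ distinct colours. Then there is a constant $C$ such that, for all sufficiently large $n$, \[\left(\frac56 n-\frac{95}{144}\right)^{1/2}\;\le\; f(n,5,6)\;\le\; n^{1/2}\,2^{C\sqrt{\log n}\,\log\log n}.\] -/

import Mathlib

/-- An edge-colouring of the complete graph on `V` is a `(p, q)`-colouring if the edges inside every
set of `p` vertices receive at least `q` distinct colours. -/
def IsPQColoring {V K : Type*} (c : SimpleGraph.TopEdgeLabeling V K) (p q : ℕ) : Prop :=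
  ∀ S : Finset V, S.card = p →
    q ≤ {k : K | ∃ x ∈ S, ∃ y ∈ S, ∃ h : x ≠ y, c.get x y h = k}.ncard

/-- The generalized Ramsey number `f(n, p, q)`: the least number `k` of colours for which the
complete graph on `n` vertices has a `(p, q)`-colouring with colours from a set of size `k`. Such a
`k` exists whenever `q ≤ p.choose 2`: give all edges different colours. -/
noncomputable def erdosGyarfas (n p q : ℕ) : ℕ :=
  sInf {k : ℕ | ∃ c : SimpleGraph.TopEdgeLabeling (Fin n) (Fin k), IsPQColoring c p q}

/-! Lower bound. In a colouring with `k` colours fix a vertex `v`, a most frequent colour `j` at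
`v`, and the set `N` of `d ≥ (n - 1) / k` vertices joined to `v` in colour `j`. Adding `v` to four
points of `N` contributes only the colour `j`, so `j` and the six pairs of the four points, seven
entries in all, take at least six values (`IsSpread`). Hence a colour other than `j` occurs at most
twice at a vertex of `N`; when it occurs twice there is a cherry (two edges of one colour at a
centre; the pair of its ends is the base). A cherry accounts for five incidences of a vertex with a
colour: its three vertices with its own colour and its two ends with the colour of the base.
Different cherries account for disjoint incidences (`covers_unique`), so the cherries number at most
a fifth of the at most `d (k - 1)` incidences. This gives `d (d - 1) ≤ (6/5) d (k - 1) + 2`, so `n`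
is at most about `6k²/5`.

Upper bound. Vertices are points `(t, y)` of the plane over `F_p` with `p` of order `√n`, and the
colour contains `t t' + y + y'`. A cherry then determines the first coordinate of its centre from
its base, and this excludes many small patterns. The rest of the colour takes only `n^{o(1)}`
values: whether `t = t'`, an orientation bit, and data of binary words of length `T b` attached
injectively to the points, namely the first difference, the first difference in each of the `T`
blocks, and both words in the block of the overall first difference.

The first difference `lam` is an ultrametric that splits every five points along a binary tree;
edges split at different depths have different colours. Five leaves allow three tree shapes
(`six_colors_caterpillar`, `six_colors_balanced`, `six_colors_triple_pair`), and in each the colours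
still missing come from the algebra and from `kap`, the first difference inside the block singled
out by a colour: edges of one colour have endpoints that match on that whole block. Taking `T = b`
of order `√(log n)` balances `2 ^ (2 b)` against `(b + 1) ^ T`. -/

/-- A symmetric function `d` with values in a linear order with top such that in every triangle
the two smallest values agree and the third is strictly larger, unless all three are `⊤`. -/
structure IsBinaryUltrametric {V L : Type*} [LinearOrder L] [OrderTop L] (d : V → V → L) :
    Prop where
  self : ∀ x, d x x = ⊤
  symm : ∀ x y, d x y = d y x
  triangle : ∀ x y z, (d x y = ⊤ ∧ d y z = ⊤ ∧ d x z = ⊤) ∨ (d x y = d y z ∧ d x y < d x z) ∨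
    (d x y = d x z ∧ d x y < d y z) ∨ (d x z = d y z ∧ d x z < d x y)

/-- The properties of the colouring of the affine plane over `F` from which the bound on the
number of colours on five points is derived. A point `v` has coordinates `t v` and `y v`. -/
structure IsPlaneColoring {V K F L M : Type*} [Field F] [LinearOrder L] [OrderTop L]
    [LinearOrder M] [OrderTop M] (c : V → V → K) (t y : V → F) (lam : K → L) (kap : K → K → M) :
    Prop where
  two_ne : (2 : F) ≠ 0
  symm : ∀ a b, c a b = c b a
  inj : ∀ a b, t a = t b → y a = y b → a = b
  form : ∀ {a b d e}, c a b = c d e → t a * t b + y a + y b = t d * t e + y d + y e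
  eq_iff : ∀ {a b d e}, c a b = c d e → (t a = t b ↔ t d = t e)
  sign : ∀ {z a b}, z ≠ a → z ≠ b → c z a = c z b → t a + t b = 2 * t z → t a = t z
  lam_ultra : IsBinaryUltrametric fun a b => lam (c a b)
  lam_ne : ∀ {a b}, a ≠ b → lam (c a b) ≠ ⊤
  kap_ultra : ∀ k, IsBinaryUltrametric fun a b => kap k (c a b)
  kap_ne : ∀ {a b}, a ≠ b → kap (c a b) (c a b) ≠ ⊤
  kap_pair : ∀ {a b d e}, a ≠ b → c a b = c d e →
    (kap (c a b) (c a d) = ⊤ ∧ kap (c a b) (c b e) = ⊤) ∨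
    (kap (c a b) (c a e) = ⊤ ∧ kap (c a b) (c b d) = ⊤)

/-! ### Forbidden configurations of the plane colouring -/

namespace IsPlaneColoring

variable {V K F L M : Type*} [Field F] [LinearOrder L] [OrderTop L] [LinearOrder M] [OrderTop M]
  {c : V → V → K} {t y : V → F} {lam : K → L} {kap : K → K → M}

theorem cherry_ne (h : IsPlaneColoring c t y lam kap) {z a b : V} (hab : a ≠ b)
    (hz : c z a = c z b) : t a ≠ t b := by
  intro ht
  have := h.form hz
  rw [ht] at this
  exact hab (h.inj a b ht (by linear_combination this))

/-- A cherry at `z` over `a, b` means `t z * (t a - t b) = y b - y a`, so the base alone fixes the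
first coordinate of the centre. -/
theorem center_eq (h : IsPlaneColoring c t y lam kap) {z w a b : V} (hab : a ≠ b)
    (hz : c z a = c z b) (hw : c w a = c w b) : t z = t w := by
  have h1 := h.form hz
  have h2 := h.form hw
  have h3 : (t z - t w) * (t a - t b) = 0 := by linear_combination h1 - h2
  rcases mul_eq_zero.1 h3 with h4 | h4
  · exact sub_eq_zero.1 h4
  · exact absurd (sub_eq_zero.1 h4) (h.cherry_ne hab hz)

/-- Two cherries with the same base cannot have their centres joined in the colour of one of
them. -/
theorem two_cherries (h : IsPlaneColoring c t y lam kap) {z w a b : V} (hab : a ≠ b)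
    (hz : c z a = c z b) (hw : c w a = c w b) (hzw : c z w = c z a) : False := by
  have h1 := h.center_eq hab hz hw
  -- The bit recording equality of first coordinates passes from `z w` to `z a` and `z b`, so `t a =
  -- t z = t b`.
  have h2 := (h.eq_iff hzw).1 h1
  have h3 := (h.eq_iff (hzw.trans hz)).1 h1
  exact h.cherry_ne hab hz (h2 ▸ h3)

/-- There is no monochromatic four-cycle. -/
theorem four_cycle (h : IsPlaneColoring c t y lam kap) {a b d e : V} (hab : a ≠ b) (hde : d ≠ e)
    (h1 : c a d = c a e) (h2 : c b d = c b e) (h3 : c a d = c b d) : False := by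
  have e1 := h.center_eq hde h1 h2
  have := h.form h3
  rw [e1] at this
  exact hab (h.inj a b e1 (by linear_combination this))

theorem alternating (h : IsPlaneColoring c t y lam kap) {a b d e : V}
    (h1 : c a d = c b e) (h2 : c a e = c b d) :
    (t a - t b) * (t d + t e) = -(2 * (y a - y b)) := by
  linear_combination h.form h1 + h.form h2

/-- The cherry gives `y a - y b = -t z * (t a - t b)`, the alternating cycle expresses twice the
same difference through `t d + t e`, and `t a - t b` cancels. The conclusion is incompatible with a
cherry at `z` over `d, e`, by `no_midpoint`. -/
theorem alternating_center (h : IsPlaneColoring c t y lam kap) {z a b d e : V} (hab : a ≠ b)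
    (hz : c z a = c z b) (h1 : c a d = c b e) (h2 : c a e = c b d) : t d + t e = 2 * t z := by
  have h3 : (t a - t b) * (t d + t e - 2 * t z) = 0 := by
    linear_combination h.alternating h1 h2 - 2 * h.form hz
  rcases mul_eq_zero.1 h3 with h4 | h4
  · exact absurd (sub_eq_zero.1 h4) (h.cherry_ne hab hz)
  · exact sub_eq_zero.1 h4

theorem no_midpoint (h : IsPlaneColoring c t y lam kap) {z d e : V} (hzd : z ≠ d) (hze : z ≠ e)
    (hde : d ≠ e) (hz : c z d = c z e) : t d + t e ≠ 2 * t z := by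
  intro h1
  have h2 := h.sign hzd hze hz h1
  exact h.cherry_ne hde hz (by linear_combination 2 * h2 - h1)

/-- An alternating four-cycle between the bases of two cherries with the same centre. -/
theorem alternating_cherries (h : IsPlaneColoring c t y lam kap) {z a b d e : V} (hab : a ≠ b)
    (hzd : z ≠ d) (hze : z ≠ e) (hde : d ≠ e) (hz : c z a = c z b) (hz' : c z d = c z e)
    (h1 : c a d = c b e) (h2 : c a e = c b d) : False :=
  h.no_midpoint hzd hze hde hz' (h.alternating_center hab hz h1 h2)

/-- Three colour classes that are perfect matchings of `{a, b, d, e}`, and a star at `z`. -/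
theorem matchings_star (h : IsPlaneColoring c t y lam kap) {z a b d e : V} (hab : a ≠ b)
    (had : a ≠ d) (hbd : b ≠ d) (h1 : c z a = c z b) (h2 : c z a = c z d) (h3 : c a b = c d e)
    (h4 : c a d = c b e) (h5 : c a e = c b d) : False := by
  have e1 := h.alternating_center hab h1 h4 h5
  have e2 := h.alternating_center had h2 h3 (h5.trans (h.symm b d))
  exact h.cherry_ne hbd (h1.symm.trans h2) (by linear_combination e2 - e1)

/-- Two disjoint edges of the same colour. -/
theorem pair_ne (h : IsPlaneColoring c t y lam kap) {a b d e : V} (hab : a ≠ b)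
    (h1 : c a b = c d e) :
    c a d ≠ c a e ∧ c a d ≠ c b d ∧ c b e ≠ c a e ∧ c b e ≠ c b d := by
  -- In the block of the first difference of `a, b`, one perfect matching between `{a, b}` and `{d,
  -- e}` has depth `⊤`; the ultrametric gives the other two cross edges the depth of `a b`, which is
  -- not `⊤`.
  have hk := h.kap_ultra (c a b)
  have hne := h.kap_ne hab
  have hne' : kap (c a b) (c d e) ≠ ⊤ := h1 ▸ hne
  have s1 := hk.triangle d a e
  have s2 := hk.triangle a d b
  have s3 := hk.triangle a e b
  have s4 := hk.triangle d b e
  rw [h.symm d a] at s1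
  rw [h.symm d b] at s2 s4
  rw [h.symm e b] at s3
  have lt {x : M} : ¬ ⊤ < x := not_top_lt
  rcases h.kap_pair hab h1 with ⟨h2, h3⟩ | ⟨h2, h3⟩ <;>
    refine ⟨fun h4 => ?_, fun h4 => ?_, fun h4 => ?_, fun h4 => ?_⟩ <;> simp_all
-- Five points: the caterpillar and the balanced tree
theorem six_le {C : Set K} {k₁ k₂ k₃ k₄ k₅ k₆ : K} (h₁ : k₁ ∈ C) (h₂ : k₂ ∈ C) (h₃ : k₃ ∈ C)
    (h₄ : k₄ ∈ C) (h₅ : k₅ ∈ C) (h₆ : k₆ ∈ C) (hl : [k₁, k₂, k₃, k₄, k₅, k₆].Nodup) :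
    6 ≤ C.encard := by
  classical
  have h : ((([k₁, k₂, k₃, k₄, k₅, k₆].toFinset : Finset K) : Set K)).encard = 6 := by
    rw [Set.encard_coe_eq_coe_finsetCard, List.toFinset_card_of_nodup hl]; rfl
  rw [← h]
  refine Set.encard_le_encard fun k hk => ?_
  simp only [List.coe_toFinset, Set.mem_ofPred_eq, List.mem_cons, List.not_mem_nil, or_false] at hk
  rcases hk with rfl | rfl | rfl | rfl | rfl | rfl <;> assumption

/-- Five points whose tree is a caterpillar. -/
theorem six_colors_caterpillar (h : IsPlaneColoring c t y lam kap) {a₀ a₁ a₂ a₃ a₄ : V}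
    (h34 : a₃ ≠ a₄) {C : Set K}
    (C01 : c a₀ a₁ ∈ C) (C02 : c a₀ a₂ ∈ C) (C03 : c a₀ a₃ ∈ C) (C04 : c a₀ a₄ ∈ C)
    (C12 : c a₁ a₂ ∈ C) (C13 : c a₁ a₃ ∈ C) (C14 : c a₁ a₄ ∈ C)
    (C23 : c a₂ a₃ ∈ C) (C24 : c a₂ a₄ ∈ C) (C34 : c a₃ a₄ ∈ C)
    {m₀ m₁ m₂ : L} (l01 : lam (c a₀ a₁) = m₀) (l02 : lam (c a₀ a₂) = m₀)
    (l03 : lam (c a₀ a₃) = m₀) (l04 : lam (c a₀ a₄) = m₀) (l12 : lam (c a₁ a₂) = m₁)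
    (l13 : lam (c a₁ a₃) = m₁) (l14 : lam (c a₁ a₄) = m₁) (l23 : lam (c a₂ a₃) = m₂)
    (l24 : lam (c a₂ a₄) = m₂) (hm01 : m₀ < m₁) (hm12 : m₁ < m₂) (hm23 : m₂ < lam (c a₃ a₄)) :
    6 ≤ C.encard := by
  -- The four depths give four colours, so two depths with a second colour suffice. If `a₂` is the
  -- centre of a cherry over `a₃, a₄`, then `n1` and `n2` give a second colour at depths `m₁` and
  -- `m₀`; otherwise depth `m₂` has two and `n3` supplies the other.
  have n1 : ¬ (c a₁ a₂ = c a₁ a₃ ∧ c a₁ a₃ = c a₁ a₄ ∧ c a₂ a₃ = c a₂ a₄) :=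
    fun ⟨x, y, z⟩ => h.two_cherries h34 y z x
  have n2 : ¬ (c a₀ a₂ = c a₀ a₃ ∧ c a₀ a₃ = c a₀ a₄ ∧ c a₂ a₃ = c a₂ a₄) :=
    fun ⟨x, y, z⟩ => h.two_cherries h34 y z x
  have n3 : ¬ (c a₀ a₁ = c a₀ a₃ ∧ c a₀ a₃ = c a₀ a₄ ∧ c a₁ a₃ = c a₁ a₄) :=
    fun ⟨x, y, z⟩ => h.two_cherries h34 y z x
  have hm02 := hm01.trans hm12
  have hm13 := hm12.trans hm23
  have hm03 := hm01.trans hm13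
  have key {k k' : K} (hk : lam k ≠ lam k') : k ≠ k' := fun e => hk (e ▸ rfl)
  by_cases e : c a₂ a₃ = c a₂ a₄
  · have o1 : c a₁ a₂ ≠ c a₁ a₃ ∨ c a₁ a₃ ≠ c a₁ a₄ := by tauto
    have o2 : c a₀ a₂ ≠ c a₀ a₃ ∨ c a₀ a₃ ≠ c a₀ a₄ := by tauto
    rcases o1 with o1 | o1 <;> rcases o2 with o2 | o2
    · refine six_le C02 C03 C12 C13 C23 C34 ?_
      simp [*, hm01.ne, hm02.ne, hm03.ne, hm12.ne, hm13.ne, hm23.ne]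
    · refine six_le C03 C04 C12 C13 C23 C34 ?_
      simp [*, hm01.ne, hm02.ne, hm03.ne, hm12.ne, hm13.ne, hm23.ne]
    · refine six_le C02 C03 C13 C14 C23 C34 ?_
      simp [*, hm01.ne, hm02.ne, hm03.ne, hm12.ne, hm13.ne, hm23.ne]
    · refine six_le C03 C04 C13 C14 C23 C34 ?_
      simp [*, hm01.ne, hm02.ne, hm03.ne, hm12.ne, hm13.ne, hm23.ne]
  · have o : c a₀ a₁ ≠ c a₀ a₃ ∨ c a₀ a₃ ≠ c a₀ a₄ ∨ c a₁ a₃ ≠ c a₁ a₄ := by tauto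
    rcases o with o | o | o
    · refine six_le C01 C03 C12 C23 C24 C34 ?_
      simp [*, hm01.ne, hm02.ne, hm03.ne, hm12.ne, hm13.ne, hm23.ne]
    · refine six_le C03 C04 C12 C23 C24 C34 ?_
      simp [*, hm01.ne, hm02.ne, hm03.ne, hm12.ne, hm13.ne, hm23.ne]
    · refine six_le C01 C13 C14 C23 C24 C34 ?_
      simp [*, hm01.ne, hm02.ne, hm03.ne, hm12.ne, hm13.ne, hm23.ne]
set_option linter.unusedSimpArgs false in
/-- Five points whose tree splits off `a₀` and then separates `a₁, a₂` from `a₃, a₄`. -/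
theorem six_colors_balanced (h : IsPlaneColoring c t y lam kap) {a₀ a₁ a₂ a₃ a₄ : V}
    (d02 : a₀ ≠ a₂) (d03 : a₀ ≠ a₃) (d04 : a₀ ≠ a₄) (d12 : a₁ ≠ a₂)
    (d13 : a₁ ≠ a₃) (d14 : a₁ ≠ a₄) (d23 : a₂ ≠ a₃) (d24 : a₂ ≠ a₄) (d34 : a₃ ≠ a₄) {C : Set K}
    (C01 : c a₀ a₁ ∈ C) (C02 : c a₀ a₂ ∈ C) (C03 : c a₀ a₃ ∈ C) (C04 : c a₀ a₄ ∈ C)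
    (C12 : c a₁ a₂ ∈ C) (C13 : c a₁ a₃ ∈ C) (C14 : c a₁ a₄ ∈ C)
    (C23 : c a₂ a₃ ∈ C) (C24 : c a₂ a₄ ∈ C) (C34 : c a₃ a₄ ∈ C)
    {m₀ m₁ : L} (l01 : lam (c a₀ a₁) = m₀) (l02 : lam (c a₀ a₂) = m₀)
    (l03 : lam (c a₀ a₃) = m₀) (l04 : lam (c a₀ a₄) = m₀) (l13 : lam (c a₁ a₃) = m₁)
    (l14 : lam (c a₁ a₄) = m₁) (l23 : lam (c a₂ a₃) = m₁) (l24 : lam (c a₂ a₄) = m₁)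
    (hm01 : m₀ < m₁) (hm12 : m₁ < lam (c a₁ a₂)) (hm34 : m₁ < lam (c a₃ a₄)) :
    6 ≤ C.encard := by
  have hm12' := hm01.trans hm12
  have hm34' := hm01.trans hm34
  have key {k k' : K} (hk : lam k ≠ lam k') : k ≠ k' := fun e => hk (e ▸ rfl)
  have q1 : ¬ (c a₀ a₁ = c a₀ a₂ ∧ c a₀ a₃ = c a₀ a₄ ∧ c a₁ a₃ = c a₂ a₄ ∧ c a₁ a₄ = c a₂ a₃) :=
    fun ⟨x, y, z, w⟩ => h.alternating_cherries d12 d03 d04 d34 x y z w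
  have q2 : ¬ (c a₀ a₁ = c a₀ a₃ ∧ c a₀ a₂ = c a₀ a₄ ∧ c a₁ a₂ = c a₃ a₄ ∧ c a₁ a₄ = c a₂ a₃) :=
    fun ⟨x, y, z, w⟩ => h.alternating_cherries d13 d02 d04 d24 x y z (h.symm a₂ a₃ ▸ w)
  have q3 : ¬ (c a₀ a₁ = c a₀ a₄ ∧ c a₀ a₂ = c a₀ a₃ ∧ c a₁ a₂ = c a₃ a₄ ∧ c a₁ a₃ = c a₂ a₄) :=
    fun ⟨x, y, z, w⟩ => h.alternating_cherries d14 d02 d03 d23 x y (h.symm a₃ a₄ ▸ z)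
      (h.symm a₂ a₄ ▸ w)
  have r : ¬ (c a₁ a₃ = c a₂ a₃ ∧ c a₁ a₄ = c a₂ a₄ ∧ c a₁ a₃ = c a₁ a₄) :=
    fun ⟨x, y, z⟩ => h.four_cycle d12 d34 z (x ▸ y ▸ z) x
  -- With one colour at the two deep edges, five must come from the star at `a₀` and the four cross
  -- edges. The latter have two colours exactly when they form two monochromatic matchings, and then
  -- the star has three; otherwise they have three, and four if the star is monochromatic.
  by_cases e : c a₁ a₂ = c a₃ a₄
  · obtain ⟨p1, p2, p3, p4⟩ := h.pair_ne d12 e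
    by_cases e' : c a₁ a₃ = c a₂ a₄ ∧ c a₁ a₄ = c a₂ a₃
    · obtain ⟨e1, e2⟩ := e'
      have t1 : ¬ (c a₀ a₁ = c a₀ a₂ ∧ c a₀ a₁ = c a₀ a₃) :=
        fun ⟨x, y⟩ => h.matchings_star d12 d13 d23 x y e e1 e2
      have t2 : ¬ (c a₀ a₁ = c a₀ a₂ ∧ c a₀ a₁ = c a₀ a₄) :=
        fun ⟨x, y⟩ => h.matchings_star d12 d14 d24 x y (h.symm a₃ a₄ ▸ e) e2 e1
      have t3 : ¬ (c a₀ a₁ = c a₀ a₃ ∧ c a₀ a₁ = c a₀ a₄) :=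
        fun ⟨x, y⟩ => h.matchings_star d13 d14 d34 x y (h.symm a₂ a₄ ▸ e1) (h.symm a₂ a₃ ▸ e2) e
      have t4 : ¬ (c a₀ a₂ = c a₀ a₃ ∧ c a₀ a₂ = c a₀ a₄) :=
        fun ⟨x, y⟩ => h.matchings_star d23 d24 d34 x y
          ((h.symm a₁ a₄ ▸ e2).symm) ((h.symm a₁ a₃ ▸ e1).symm) (by rw [h.symm, e])
      have o : (c a₀ a₁ ≠ c a₀ a₃ ∧ c a₀ a₁ ≠ c a₀ a₄ ∧ c a₀ a₃ ≠ c a₀ a₄) ∨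
          (c a₀ a₁ ≠ c a₀ a₂ ∧ c a₀ a₁ ≠ c a₀ a₄ ∧ c a₀ a₂ ≠ c a₀ a₄) ∨
          (c a₀ a₁ ≠ c a₀ a₂ ∧ c a₀ a₁ ≠ c a₀ a₃ ∧ c a₀ a₂ ≠ c a₀ a₃) := by grind
      rcases o with o | o | o
      · exact six_le C01 C03 C04 C13 C14 C12 (by
          simp [key, l01, l02, l03, l04, l13, l14, l23, l24, hm01.ne, hm12.ne, hm12'.ne,
            hm34.ne, hm34'.ne, p1, o])
      · exact six_le C01 C02 C04 C13 C14 C12 (by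
          simp [key, l01, l02, l03, l04, l13, l14, l23, l24, hm01.ne, hm12.ne, hm12'.ne,
            hm34.ne, hm34'.ne, p1, o])
      · exact six_le C01 C02 C03 C13 C14 C12 (by
          simp [key, l01, l02, l03, l04, l13, l14, l23, l24, hm01.ne, hm12.ne, hm12'.ne,
            hm34.ne, hm34'.ne, p1, o])
    · by_cases s : c a₀ a₁ = c a₀ a₂ ∧ c a₀ a₂ = c a₀ a₃ ∧ c a₀ a₃ = c a₀ a₄
      · obtain ⟨s1, s2, s3⟩ := s
        have v1 : c a₁ a₃ ≠ c a₂ a₄ := fun v => q3 ⟨(s1.trans s2).trans s3, s2, e, v⟩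
        have v2 : c a₁ a₄ ≠ c a₂ a₃ := fun v => q2 ⟨s1.trans s2, s2.trans s3, e, v⟩
        exact six_le C01 C13 C24 C14 C23 C12 (by
          simp [key, l01, l02, l03, l04, l13, l14, l23, l24, hm01.ne, hm12.ne, hm12'.ne,
            hm34.ne, hm34'.ne, p1, p2, p3, p4, v1, v2])
      · have o : c a₀ a₁ ≠ c a₀ a₂ ∨ c a₀ a₂ ≠ c a₀ a₃ ∨ c a₀ a₃ ≠ c a₀ a₄ := by
          simpa only [not_and_or] using s
        have o' : c a₁ a₃ ≠ c a₂ a₄ ∨ c a₁ a₄ ≠ c a₂ a₃ := not_and_or.1 e'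
        rcases o with o | o | o <;> rcases o' with o' | o'
        · exact six_le C01 C02 C13 C24 C14 C12 (by
          simp [key, l01, l02, l03, l04, l13, l14, l23, l24, hm01.ne, hm12.ne, hm12'.ne,
            hm34.ne, hm34'.ne, p1, p2, p3, p4, o, o'])
        · exact six_le C01 C02 C13 C14 C23 C12 (by
          simp [key, l01, l02, l03, l04, l13, l14, l23, l24, hm01.ne, hm12.ne, hm12'.ne,
            hm34.ne, hm34'.ne, p1, p2, p3, p4, o, o'])
        · exact six_le C02 C03 C13 C24 C14 C12 (by
          simp [key, l01, l02, l03, l04, l13, l14, l23, l24, hm01.ne, hm12.ne, hm12'.ne,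
            hm34.ne, hm34'.ne, p1, p2, p3, p4, o, o'])
        · exact six_le C02 C03 C13 C14 C23 C12 (by
          simp [key, l01, l02, l03, l04, l13, l14, l23, l24, hm01.ne, hm12.ne, hm12'.ne,
            hm34.ne, hm34'.ne, p1, p2, p3, p4, o, o'])
        · exact six_le C03 C04 C13 C24 C14 C12 (by
          simp [key, l01, l02, l03, l04, l13, l14, l23, l24, hm01.ne, hm12.ne, hm12'.ne,
            hm34.ne, hm34'.ne, p1, p2, p3, p4, o, o'])
        · exact six_le C03 C04 C13 C14 C23 C12 (by
          simp [key, l01, l02, l03, l04, l13, l14, l23, l24, hm01.ne, hm12.ne, hm12'.ne,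
            hm34.ne, hm34'.ne, p1, p2, p3, p4, o, o'])
  -- Two deep colours: a monochromatic star forces three cross colours; otherwise star and cross
  -- edges have at least two each.
  · by_cases s : c a₀ a₁ = c a₀ a₂ ∧ c a₀ a₂ = c a₀ a₃ ∧ c a₀ a₃ = c a₀ a₄
    · obtain ⟨s1, s2, s3⟩ := s
      have u1 : c a₁ a₃ ≠ c a₁ a₄ := fun u => h.two_cherries d34 s3 u (s1.trans s2)
      have u2 : c a₁ a₃ ≠ c a₂ a₃ := fun u =>
        h.two_cherries d12 s1 (by rw [h.symm a₃ a₁, h.symm a₃ a₂, u]) (s1.trans s2).symm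
      have u3 : c a₁ a₄ ≠ c a₂ a₄ := fun u =>
        h.two_cherries d12 s1 (by rw [h.symm a₄ a₁, h.symm a₄ a₂, u]) ((s1.trans s2).trans s3).symm
      by_cases v : c a₁ a₃ = c a₂ a₄
      · have v2 : c a₁ a₄ ≠ c a₂ a₃ := fun w => q1 ⟨s1, s3, v, w⟩
        exact six_le C01 C13 C14 C23 C12 C34 (by
          simp [key, l01, l02, l03, l04, l13, l14, l23, l24, hm01.ne, hm12.ne, hm12'.ne,
            hm34.ne, hm34'.ne, e, v2, u1, u2, u3])
      · exact six_le C01 C13 C14 C24 C12 C34 (by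
          simp [key, l01, l02, l03, l04, l13, l14, l23, l24, hm01.ne, hm12.ne, hm12'.ne,
            hm34.ne, hm34'.ne, e, v, u1, u2, u3])
    · have o : c a₀ a₁ ≠ c a₀ a₂ ∨ c a₀ a₂ ≠ c a₀ a₃ ∨ c a₀ a₃ ≠ c a₀ a₄ := by
          simpa only [not_and_or] using s
      have o' : c a₁ a₃ ≠ c a₂ a₃ ∨ c a₁ a₄ ≠ c a₂ a₄ ∨ c a₁ a₃ ≠ c a₁ a₄ := by
        simpa only [not_and_or] using r
      rcases o with o | o | o <;> rcases o' with o' | o' | o'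
      · exact six_le C01 C02 C13 C23 C12 C34 (by
          simp [key, l01, l02, l03, l04, l13, l14, l23, l24, hm01.ne, hm12.ne, hm12'.ne,
            hm34.ne, hm34'.ne, e, o, o'])
      · exact six_le C01 C02 C14 C24 C12 C34 (by
          simp [key, l01, l02, l03, l04, l13, l14, l23, l24, hm01.ne, hm12.ne, hm12'.ne,
            hm34.ne, hm34'.ne, e, o, o'])
      · exact six_le C01 C02 C13 C14 C12 C34 (by
          simp [key, l01, l02, l03, l04, l13, l14, l23, l24, hm01.ne, hm12.ne, hm12'.ne,
            hm34.ne, hm34'.ne, e, o, o'])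
      · exact six_le C02 C03 C13 C23 C12 C34 (by
          simp [key, l01, l02, l03, l04, l13, l14, l23, l24, hm01.ne, hm12.ne, hm12'.ne,
            hm34.ne, hm34'.ne, e, o, o'])
      · exact six_le C02 C03 C14 C24 C12 C34 (by
          simp [key, l01, l02, l03, l04, l13, l14, l23, l24, hm01.ne, hm12.ne, hm12'.ne,
            hm34.ne, hm34'.ne, e, o, o'])
      · exact six_le C02 C03 C13 C14 C12 C34 (by
          simp [key, l01, l02, l03, l04, l13, l14, l23, l24, hm01.ne, hm12.ne, hm12'.ne,
            hm34.ne, hm34'.ne, e, o, o'])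
      · exact six_le C03 C04 C13 C23 C12 C34 (by
          simp [key, l01, l02, l03, l04, l13, l14, l23, l24, hm01.ne, hm12.ne, hm12'.ne,
            hm34.ne, hm34'.ne, e, o, o'])
      · exact six_le C03 C04 C14 C24 C12 C34 (by
          simp [key, l01, l02, l03, l04, l13, l14, l23, l24, hm01.ne, hm12.ne, hm12'.ne,
            hm34.ne, hm34'.ne, e, o, o'])
      · exact six_le C03 C04 C13 C14 C12 C34 (by
          simp [key, l01, l02, l03, l04, l13, l14, l23, l24, hm01.ne, hm12.ne, hm12'.ne,
            hm34.ne, hm34'.ne, e, o, o'])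
end IsPlaneColoring

/-! ### Five points: colours between a triple and a pair -/

theorem Set.three_le_encard {K : Type*} {S : Set K} {k : K} (hk : k ∈ S)
    (h : ¬ ∃ A B, ∀ k ∈ S, k = A ∨ k = B) : 3 ≤ S.encard := by
  push Not at h
  obtain ⟨l, hl, h1, -⟩ := h k k
  obtain ⟨m, hm, h3, h4⟩ := h k l
  rw [← (Set.encard_eq_three (s := {k, l, m})).2 ⟨k, l, m, h1.symm, h3.symm, h4.symm, rfl⟩]
  exact Set.encard_le_encard (by rintro x (rfl | rfl | rfl) <;> assumption)

namespace IsPlaneColoring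

variable {V K F L M : Type*} [Field F] [LinearOrder L] [OrderTop L] [LinearOrder M] [OrderTop M]
  {c : V → V → K} {t y : V → F} {lam : K → L} {kap : K → K → M}

/-- The colours between a pair `a₃, a₄` and three points two of which are joined in the colour of
`a₃, a₄`. -/
theorem three_le_cross_of_eq (h : IsPlaneColoring c t y lam kap) {a₀ a₁ a₂ a₃ a₄ : V}
    (d01 : a₀ ≠ a₁) (d02 : a₀ ≠ a₂) (d12 : a₁ ≠ a₂) (d34 : a₃ ≠ a₄) (e : c a₀ a₁ = c a₃ a₄) :
    3 ≤ ({c a₀ a₃, c a₀ a₄, c a₁ a₃, c a₁ a₄, c a₂ a₃, c a₂ a₄} : Set K).encard := by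
  obtain ⟨p1, p2, p3, p4⟩ := h.pair_ne d01 e
  have s := h.symm
  have hk := h.kap_ultra (c a₀ a₁)
  have hne' : kap (c a₀ a₁) (c a₃ a₄) ≠ ⊤ := e ▸ h.kap_ne d01
  have hkp := h.kap_pair d01 e
  have tr := hk.triangle a₃ a₂ a₄
  have tr1 := hk.triangle a₃ a₀ a₄
  rw [s a₃ a₂] at tr
  rw [s a₃ a₀] at tr1
  -- By `pair_ne`, two colours would have to alternate on the edges from `a₀, a₁`; `q1` to `q4`
  -- exclude the four ways to continue at `a₂`. In `q1` and `q2` the depths in the block would make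
  -- `a₃ a₄` have depth `⊤` or produce three equal depths other than `⊤`.
  have q1 : ¬ (c a₀ a₃ = c a₁ a₄ ∧ c a₀ a₄ = c a₁ a₃ ∧ c a₂ a₃ = c a₀ a₃ ∧ c a₂ a₄ = c a₀ a₃) := by
    rintro ⟨x, w, z, v⟩
    rw [z, v] at tr
    rw [← w, ← x] at hkp
    have lt {x : M} : ¬ ⊤ < x := not_top_lt
    clear z v w x e p1 p2 p3 p4
    rcases hkp with ⟨h1, -⟩ | ⟨h1, -⟩
    · simp_all
    · simp_all only [true_and, and_true, lt_irrefl, or_false, false_or, and_false]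
      grind
  have q2 : ¬ (c a₀ a₃ = c a₁ a₄ ∧ c a₀ a₄ = c a₁ a₃ ∧ c a₂ a₃ = c a₀ a₄ ∧ c a₂ a₄ = c a₀ a₄) := by
    rintro ⟨x, w, z, v⟩
    rw [z, v] at tr
    rw [← w, ← x] at hkp
    have lt {x : M} : ¬ ⊤ < x := not_top_lt
    clear z v w x e p1 p2 p3 p4
    rcases hkp with ⟨h1, -⟩ | ⟨h1, -⟩ <;> simp_all
  have q {i} (d0 : i ≠ a₂) (h1 : c a₀ a₃ = c a₁ a₄) (h2 : c a₀ a₄ = c a₁ a₃)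
      (h3 : c i a₃ = c a₂ a₃) (h4 : c i a₄ = c a₂ a₄) : False := by
    have e1 := h.center_eq (z := a₃) (w := a₄) d0 (by rwa [s a₃, s a₃]) (by rwa [s a₄, s a₄])
    have e2 := h.alternating (a := a₃) (b := a₄) (d := a₀) (e := a₁) (by rwa [s a₃, s a₄])
      (by rw [s a₃, s a₄, h2])
    have e3 : 2 * (y a₃ - y a₄) = 0 := by rw [e1] at e2; linear_combination e2
    exact d34 (h.inj _ _ e1 (sub_eq_zero.1 ((mul_eq_zero.1 e3).resolve_left h.two_ne)))
  have q3 := q d02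
  have q4 := q d12
  clear tr tr1 hkp hk hne' s
  refine Set.three_le_encard (Set.mem_insert _ _) ?_
  rintro ⟨A, B, hAB⟩
  simp only [Set.mem_insert_iff, Set.mem_singleton_iff, forall_eq_or_imp, forall_eq] at hAB
  grind

/-- The colours between a pair `a₃, a₄` and three points that span a cherry. -/
theorem three_le_cross_of_cherry (h : IsPlaneColoring c t y lam kap) {a₀ a₁ a₂ a₃ a₄ : V}
    (d01 : a₀ ≠ a₁) (d02 : a₀ ≠ a₂) (d12 : a₁ ≠ a₂) (d03 : a₀ ≠ a₃) (d04 : a₀ ≠ a₄)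
    (d13 : a₁ ≠ a₃) (d14 : a₁ ≠ a₄) (d23 : a₂ ≠ a₃) (d24 : a₂ ≠ a₄) (d34 : a₃ ≠ a₄)
    (e : c a₂ a₀ = c a₂ a₁) :
    3 ≤ ({c a₀ a₃, c a₀ a₄, c a₁ a₃, c a₁ a₄, c a₂ a₃, c a₂ a₄} : Set K).encard := by
  have s := h.symm
  have ne := h.cherry_ne d01 e
  -- The facts below exclude every way to colour the six cross edges with two colours; the closing
  -- `grind` is that finite check.
  have p1 : ∀ i, ¬ (c a₀ i = c a₁ i ∧ c a₂ i = c a₀ i) := fun i ⟨x, z⟩ =>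
    h.two_cherries d01 (z := i) (by rwa [s i, s i]) e (by rw [s i, s i, z])
  have cen : ∀ {i}, c a₀ i = c a₁ i → t i = t a₂ := fun {i} x =>
    h.center_eq d01 (z := i) (by rwa [s i, s i]) e
  have p3 : ∀ i j, i ≠ j → ¬ (c i a₃ = c i a₄ ∧ c j a₃ = c j a₄ ∧ c i a₃ = c j a₃) :=
    fun i j d ⟨x, z, w⟩ => h.four_cycle d d34 x z w
  have p4 : ∀ i j, ¬ (c a₀ i = c a₁ i ∧ c a₂ i = c a₀ j ∧ c a₂ i = c a₁ j) := fun i j ⟨x, z, w⟩ =>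
    ne (((h.eq_iff z).1 (cen x).symm).trans ((h.eq_iff w).1 (cen x).symm).symm)
  have p5 : ∀ i j, i ≠ j → ¬ (c a₀ i = c a₁ i ∧ c a₂ i = c a₂ j) := fun i j d ⟨x, z⟩ =>
    h.cherry_ne d z ((cen x).trans ((h.eq_iff z).1 (cen x).symm))
  have p7 : ¬ (c a₀ a₃ = c a₀ a₄ ∧ c a₁ a₃ = c a₁ a₄) := fun ⟨x, z⟩ =>
    ne (h.center_eq d34 x z)
  have p8 : ¬ (c a₀ a₃ = c a₁ a₄ ∧ c a₀ a₄ = c a₁ a₃ ∧ c a₂ a₃ = c a₂ a₄) := fun ⟨x, z, w⟩ =>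
    h.alternating_cherries d01 d23 d24 d34 e w x z
  have p9 {i} (x : c a₀ a₃ = c a₁ a₄) (z : c a₀ a₄ = c a₁ a₃) (d : i ≠ a₂) (w : c i a₃ = c a₂ a₃)
      (v : c i a₄ = c a₂ a₄) (hi : t i ≠ t a₂) : False := by
    have e1 := h.center_eq d (z := a₃) (w := a₄) (by rwa [s a₃, s a₃]) (by rwa [s a₄, s a₄])
    have e2 := h.alternating_center d01 e x z
    have e3 : t a₂ = t a₃ := by
      have : 2 * (t a₂ - t a₃) = 0 := by rw [e1] at e2 ⊢; linear_combination -e2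
      exact sub_eq_zero.1 ((mul_eq_zero.1 this).resolve_left h.two_ne)
    exact hi (((h.eq_iff w).2 e3).trans e3.symm)
  have p9a : ¬ (c a₀ a₃ = c a₁ a₄ ∧ c a₀ a₄ = c a₁ a₃ ∧ c a₀ a₃ = c a₂ a₃ ∧ c a₀ a₄ = c a₂ a₄) :=
    fun ⟨x, z, w, v⟩ => p9 x z d02 w v (h.cherry_ne d02 (z := a₃) (by rwa [s a₃, s a₃]))
  have p9b : ¬ (c a₀ a₃ = c a₁ a₄ ∧ c a₀ a₄ = c a₁ a₃ ∧ c a₁ a₃ = c a₂ a₃ ∧ c a₁ a₄ = c a₂ a₄) :=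
    fun ⟨x, z, w, v⟩ => p9 x z d12 w v (h.cherry_ne d12 (z := a₃) (by rwa [s a₃, s a₃]))
  -- The equality bit turns `t a₂ = t k` into `t j = t l`. The four form equations then factor, so
  -- the cherry at `i` over `k, l` has ends with equal `t` or has `i` as midpoint.
  have p6 : ∀ i j k l, i ≠ k → i ≠ l → k ≠ l → c a₂ i = c a₂ j → 
      ¬ (c i k = c i l ∧ c i l = c a₂ l ∧ c a₂ k = c j l ∧ t a₂ = t k) := by
    rintro i j k l d1 d2 d3 e ⟨f2, f3, f4, e1⟩
    have e2 := (h.eq_iff f4).1 e1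
    have F := h.form e
    have F2 := h.form f2
    have F3 := h.form f3
    have F4 := h.form f4
    have h3 : (t k - t l) * (t k + t l - 2 * t i) = 0 := by
      rw [e1] at F F3 F4
      rw [e2] at F F4
      linear_combination F4 - F + F3 - F2
    rcases mul_eq_zero.1 h3 with h4 | h4
    · exact h.cherry_ne d3 f2 (sub_eq_zero.1 h4)
    · exact h.no_midpoint d1 d2 d3 f2 (sub_eq_zero.1 h4)
  have g1 := p1 a₃
  have g2 := p1 a₄
  have g3 := p3 a₀ a₁ d01
  have g4 := p3 a₀ a₂ d02
  have g5 := p3 a₁ a₂ d12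
  have g6 := p4 a₃ a₄
  have g7 := p4 a₄ a₃
  have g8 := p5 a₃ a₄ d34
  have g9 := p5 a₄ a₃ d34.symm
  have r1 : ¬ (c a₀ a₃ = c a₁ a₃ ∧ c a₀ a₃ = c a₀ a₄ ∧ c a₀ a₄ = c a₂ a₄ ∧ c a₂ a₃ = c a₁ a₄) :=
    fun ⟨x, z, w, v⟩ => p6 a₀ a₁ a₃ a₄ d03 d04 d34 e ⟨z, w, v, (cen x).symm⟩
  have r2 : ¬ (c a₀ a₃ = c a₁ a₃ ∧ c a₁ a₃ = c a₁ a₄ ∧ c a₁ a₄ = c a₂ a₄ ∧ c a₂ a₃ = c a₀ a₄) :=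
    fun ⟨x, z, w, v⟩ => p6 a₁ a₀ a₃ a₄ d13 d14 d34 e.symm ⟨z, w, v, (cen x).symm⟩
  have r3 : ¬ (c a₀ a₄ = c a₁ a₄ ∧ c a₀ a₄ = c a₀ a₃ ∧ c a₀ a₃ = c a₂ a₃ ∧ c a₂ a₄ = c a₁ a₃) :=
    fun ⟨x, z, w, v⟩ => p6 a₀ a₁ a₄ a₃ d04 d03 d34.symm e ⟨z, w, v, (cen x).symm⟩
  have r4 : ¬ (c a₀ a₄ = c a₁ a₄ ∧ c a₁ a₄ = c a₁ a₃ ∧ c a₁ a₃ = c a₂ a₃ ∧ c a₂ a₄ = c a₀ a₃) :=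
    fun ⟨x, z, w, v⟩ => p6 a₁ a₀ a₄ a₃ d14 d13 d34.symm e.symm ⟨z, w, v, (cen x).symm⟩
  clear p1 p3 p4 p5 p6 p9 cen s ne
  refine Set.three_le_encard (Set.mem_insert _ _) ?_
  rintro ⟨A, B, hAB⟩
  simp only [Set.mem_insert_iff, Set.mem_singleton_iff, forall_eq_or_imp, forall_eq] at hAB
  grind
theorem four_le {C : Set K} {k₁ k₂ k₃ k₄ : K} (h₁ : k₁ ∈ C) (h₂ : k₂ ∈ C) (h₃ : k₃ ∈ C)
    (h₄ : k₄ ∈ C) (hl : [k₁, k₂, k₃, k₄].Nodup) : 4 ≤ C.encard := by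
  classical
  have h : ((([k₁, k₂, k₃, k₄].toFinset : Finset K) : Set K)).encard = 4 := by
    rw [Set.encard_coe_eq_coe_finsetCard, List.toFinset_card_of_nodup hl]; rfl
  rw [← h]
  refine Set.encard_le_encard fun k hk => ?_
  simp only [List.coe_toFinset, Set.mem_ofPred_eq, List.mem_cons, List.not_mem_nil, or_false] at hk
  rcases hk with rfl | rfl | rfl | rfl <;> assumption

set_option linter.unusedSimpArgs false in
/-- The colours between a pair `a₃, a₄` and a triple with centre `a₂` whose base has the colour of
`a₃, a₄`. -/
theorem four_le_cross_of_base (h : IsPlaneColoring c t y lam kap) {a₀ a₁ a₂ a₃ a₄ : V}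
    (d01 : a₀ ≠ a₁) (d23 : a₂ ≠ a₃) (d24 : a₂ ≠ a₄) (d34 : a₃ ≠ a₄)
    (e : c a₂ a₀ = c a₂ a₁) (e' : c a₀ a₁ = c a₃ a₄)
    (k03 : kap (c a₀ a₁) (c a₀ a₃) = ⊤) (k14 : kap (c a₀ a₁) (c a₁ a₄) = ⊤) :
    4 ≤ ({c a₀ a₃, c a₀ a₄, c a₁ a₃, c a₁ a₄, c a₂ a₃, c a₂ a₄} : Set K).encard := by
  have s := h.symm
  have hk := h.kap_ultra (c a₀ a₁)
  have hne : kap (c a₀ a₁) (c a₀ a₁) ≠ ⊤ := h.kap_ne d01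
  have hne' : kap (c a₀ a₁) (c a₃ a₄) ≠ ⊤ := e' ▸ h.kap_ne d01
  have t1 := hk.triangle a₀ a₁ a₃
  have t2 := hk.triangle a₀ a₁ a₄
  have t3 := hk.triangle a₀ a₁ a₂
  have t4 := hk.triangle a₀ a₂ a₃
  have t5 := hk.triangle a₁ a₂ a₄
  rw [s a₀ a₂, s a₁ a₂, e] at t3
  rw [s a₀ a₂, e] at t4
  rw [s a₁ a₂] at t5
  have o : ¬ (c a₀ a₃ = c a₁ a₄ ∧ c a₀ a₄ = c a₁ a₃ ∧ c a₂ a₃ = c a₂ a₄) := fun ⟨x, z, w⟩ =>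
    h.alternating_cherries d01 d23 d24 d34 e w x z
  have key {k k' : K} (hk : kap (c a₀ a₁) k ≠ kap (c a₀ a₁) k') : k ≠ k' := fun e => hk (e ▸ rfl)
  have lt {x : M} : ¬ ⊤ < x := not_top_lt
  -- The cross edges fall into three classes by depth in the block, `{03, 14}`, `{04, 13}` and `{23,
  -- 24}`. By `o` at least one of them has two colours.
  have k04 : kap (c a₀ a₁) (c a₀ a₄) = kap (c a₀ a₁) (c a₀ a₁) := by clear t1 t3 t4 t5; grind
  have k13 : kap (c a₀ a₁) (c a₁ a₃) = kap (c a₀ a₁) (c a₀ a₁) := by clear t2 t3 t4 t5; grind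
  have k23 : kap (c a₀ a₁) (c a₂ a₃) = kap (c a₀ a₁) (c a₂ a₁) := by clear t1 t2 t3 t5; grind
  have k24 : kap (c a₀ a₁) (c a₂ a₄) = kap (c a₀ a₁) (c a₂ a₁) := by clear t1 t2 t3 t4; grind
  have k21 : kap (c a₀ a₁) (c a₂ a₁) < kap (c a₀ a₁) (c a₀ a₁) := by clear t1 t2 t4 t5; grind
  have k21' : kap (c a₀ a₁) (c a₂ a₁) < ⊤ := k21.trans hne.lt_top
  rcases not_and_or.1 o with o | o
  · exact four_le (k₁ := c a₀ a₃) (k₂ := c a₁ a₄) (k₃ := c a₀ a₄) (k₄ := c a₂ a₃)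
      (by simp) (by simp) (by simp) (by simp) (by
        simp [key, k03, k14, k04, k13, k23, k24, o, k21.ne', k21'.ne', hne.symm])
  rcases not_and_or.1 o with o | o
  · exact four_le (k₁ := c a₀ a₃) (k₂ := c a₀ a₄) (k₃ := c a₁ a₃) (k₄ := c a₂ a₃)
      (by simp) (by simp) (by simp) (by simp) (by
        simp [key, k03, k14, k04, k13, k23, k24, o, k21.ne', k21'.ne', hne.symm])
  · exact four_le (k₁ := c a₀ a₃) (k₂ := c a₀ a₄) (k₃ := c a₂ a₃) (k₄ := c a₂ a₄)
      (by simp) (by simp) (by simp) (by simp) (by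
        simp [key, k03, k14, k04, k13, k23, k24, o, k21.ne', k21'.ne', hne.symm])

set_option linter.unusedSimpArgs false in
/-- The colours between a pair `a₃, a₄` and a triple with centre `a₂` whose legs have the colour
of `a₃, a₄`. -/
theorem four_le_cross_of_leg (h : IsPlaneColoring c t y lam kap) {a₀ a₁ a₂ a₃ a₄ : V}
    (d01 : a₀ ≠ a₁) (d02 : a₀ ≠ a₂) (d12 : a₁ ≠ a₂) (d04 : a₀ ≠ a₄) (d14 : a₁ ≠ a₄)
    (d24 : a₂ ≠ a₄) (e : c a₂ a₀ = c a₂ a₁) (e' : c a₀ a₂ = c a₃ a₄)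
    (k04 : kap (c a₀ a₂) (c a₀ a₄) = ⊤) (k23 : kap (c a₀ a₂) (c a₂ a₃) = ⊤) :
    4 ≤ ({c a₀ a₃, c a₀ a₄, c a₁ a₃, c a₁ a₄, c a₂ a₃, c a₂ a₄} : Set K).encard := by
  have s := h.symm
  have hk := h.kap_ultra (c a₀ a₂)
  have hne : kap (c a₀ a₂) (c a₀ a₂) ≠ ⊤ := h.kap_ne d02
  have e1 : c a₀ a₂ = c a₁ a₂ := by rw [s a₀, s a₁, e]
  -- The edge `a₁ a₂` also has the colour of `a₃ a₄`. The other matching would give `a₁ a₃` depth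
  -- `⊤` along with `a₂ a₃`, hence `a₁ a₂` too.
  have k14 : kap (c a₀ a₂) (c a₁ a₄) = ⊤ := by
    have := h.kap_pair d12 (e1.symm.trans e')
    rw [← e1] at this
    rcases this with ⟨h1, -⟩ | ⟨h1, -⟩
    · have := hk.triangle a₁ a₂ a₃
      rw [← e1] at this
      have lt {x : M} : ¬ ⊤ < x := not_top_lt
      simp_all
    · exact h1
  have t1 := hk.triangle a₂ a₀ a₄
  have t2 := hk.triangle a₀ a₄ a₃
  have t3 := hk.triangle a₁ a₄ a₃
  rw [s a₂ a₀] at t1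
  rw [s a₄ a₃, ← e'] at t2 t3
  have key {k k' : K} (hk : kap (c a₀ a₂) k ≠ kap (c a₀ a₂) k') : k ≠ k' := fun e => hk (e ▸ rfl)
  have lt {x : M} : ¬ ⊤ < x := not_top_lt
  have k24 : kap (c a₀ a₂) (c a₂ a₄) = kap (c a₀ a₂) (c a₀ a₂) := by clear t2 t3; grind
  have k03 : kap (c a₀ a₂) (c a₀ a₃) = kap (c a₀ a₂) (c a₀ a₂) := by clear t1 t3; grind
  have k13 : kap (c a₀ a₂) (c a₁ a₃) = kap (c a₀ a₂) (c a₀ a₂) := by clear t1 t2; grind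
  have ne := h.cherry_ne d01 e
  have cen : ∀ {i}, c a₀ i = c a₁ i → t i = t a₂ := fun {i} x =>
    h.center_eq d01 (z := i) (by rwa [s i, s i]) e
  have f1 : ¬ (c a₂ a₄ = c a₀ a₃ ∧ c a₀ a₃ = c a₁ a₃ ∧ c a₀ a₄ = c a₁ a₄) := by
    rintro ⟨x, z, w⟩
    have := (h.eq_iff x).1 (cen w).symm
    have h2 := (h.eq_iff (x.trans z)).1 (cen w).symm
    exact ne (this.trans h2.symm)
  have f2 {i j} (dj : i ≠ a₄) (h1 : c i a₂ = c a₃ a₄) (x : c a₂ a₄ = c i a₃)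
      (z : c i a₃ = c j a₃) (w : c a₂ a₃ = c i a₄) (h0 : t a₃ = t a₂) : False := by
    have h2 := (h.eq_iff w).1 h0.symm
    have F1 := h.form h1
    have F2 := h.form x
    rw [h0, h2] at F1
    rw [h0, h2] at F2
    exact dj (h.inj _ _ h2 (sub_eq_zero.1 ((mul_eq_zero.1
      (show 2 * (y i - y a₄) = 0 by linear_combination F1 - F2)).resolve_left h.two_ne)))
  have f2a : ¬ (c a₂ a₄ = c a₀ a₃ ∧ c a₀ a₃ = c a₁ a₃ ∧ c a₂ a₃ = c a₀ a₄) :=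
    fun ⟨x, z, w⟩ => f2 d04 e' x z w (cen z)
  have f2b : ¬ (c a₂ a₄ = c a₀ a₃ ∧ c a₀ a₃ = c a₁ a₃ ∧ c a₂ a₃ = c a₁ a₄) :=
    fun ⟨x, z, w⟩ => f2 d14 (e1.symm.trans e') (x.trans z) z.symm w (cen z)
  have f3 : ¬ (c a₂ a₃ = c a₀ a₄ ∧ c a₀ a₄ = c a₁ a₄ ∧ c a₀ a₃ = c a₁ a₃) := by
    rintro ⟨x, z, w⟩
    have := (h.eq_iff x).1 (cen w).symm
    have h2 := (h.eq_iff (x.trans z)).1 (cen w).symm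
    exact ne (this.trans h2.symm)
  have f4 {i} (h1 : c i a₂ = c a₃ a₄) (x : c a₂ a₄ = c i a₃) (w : c a₂ a₃ = c i a₄)
      (h0 : t a₄ = t a₂) : False := by
    have h2 := (h.eq_iff x).1 h0.symm
    have F1 := h.form h1
    have F2 := h.form w
    rw [h0, h2] at F1 F2
    exact d24 (h.inj _ _ h0.symm (sub_eq_zero.1 ((mul_eq_zero.1
      (show 2 * (y a₂ - y a₄) = 0 by linear_combination F1 + F2)).resolve_left h.two_ne)))
  have f4a : ¬ (c a₂ a₃ = c a₀ a₄ ∧ c a₀ a₄ = c a₁ a₄ ∧ c a₂ a₄ = c a₀ a₃) :=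
    fun ⟨x, z, w⟩ => f4 e' w x (cen z)
  have f4b : ¬ (c a₂ a₃ = c a₀ a₄ ∧ c a₀ a₄ = c a₁ a₄ ∧ c a₂ a₄ = c a₁ a₃) :=
    fun ⟨x, z, w⟩ => f4 (e1.symm.trans e') w (x.trans z) (cen z)
  have hne2 := hne.symm
  clear t1 t2 t3
  -- Depth in the block separates `{23, 04, 14}` from `{24, 03, 13}`. If one class is monochromatic,
  -- the other has three colours by `f1` to `f4b`; otherwise each has at least two.
  by_cases hT : c a₂ a₃ = c a₀ a₄ ∧ c a₀ a₄ = c a₁ a₄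
  · have n1 : c a₀ a₃ ≠ c a₁ a₃ := fun x => f3 ⟨hT.1, hT.2, x⟩
    have n2 : c a₂ a₄ ≠ c a₀ a₃ := fun x => f4a ⟨hT.1, hT.2, x⟩
    have n3 : c a₂ a₄ ≠ c a₁ a₃ := fun x => f4b ⟨hT.1, hT.2, x⟩
    exact four_le (k₁ := c a₀ a₄) (k₂ := c a₂ a₄) (k₃ := c a₀ a₃) (k₄ := c a₁ a₃)
      (by simp) (by simp) (by simp) (by simp) (by
        simp [key, k04, k24, k03, k13, n1, n2, n3, hne2])
  by_cases hN : c a₂ a₄ = c a₀ a₃ ∧ c a₀ a₃ = c a₁ a₃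
  · have n1 : c a₀ a₄ ≠ c a₁ a₄ := fun x => f1 ⟨hN.1, hN.2, x⟩
    have n2 : c a₂ a₃ ≠ c a₀ a₄ := fun x => f2a ⟨hN.1, hN.2, x⟩
    have n3 : c a₂ a₃ ≠ c a₁ a₄ := fun x => f2b ⟨hN.1, hN.2, x⟩
    exact four_le (k₁ := c a₂ a₃) (k₂ := c a₀ a₄) (k₃ := c a₁ a₄) (k₄ := c a₁ a₃)
      (by simp) (by simp) (by simp) (by simp) (by
        simp [key, k04, k14, k23, k13, n1, n2, n3, hne2])
  rcases not_and_or.1 hT with o | o <;> rcases not_and_or.1 hN with o' | o'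
  · exact four_le (k₁ := c a₂ a₃) (k₂ := c a₀ a₄) (k₃ := c a₂ a₄) (k₄ := c a₀ a₃)
      (by simp) (by simp) (by simp) (by simp) (by
        simp [key, k04, k03, k23, k24, o, o', hne2])
  · exact four_le (k₁ := c a₂ a₃) (k₂ := c a₀ a₄) (k₃ := c a₀ a₃) (k₄ := c a₁ a₃)
      (by simp) (by simp) (by simp) (by simp) (by
        simp [key, k04, k03, k23, k13, o, o', hne2])
  · exact four_le (k₁ := c a₀ a₄) (k₂ := c a₁ a₄) (k₃ := c a₂ a₄) (k₄ := c a₀ a₃)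
      (by simp) (by simp) (by simp) (by simp) (by
        simp [key, k04, k03, k14, k24, o, o', hne2])
  · exact four_le (k₁ := c a₀ a₄) (k₂ := c a₁ a₄) (k₃ := c a₀ a₃) (k₄ := c a₁ a₃)
      (by simp) (by simp) (by simp) (by simp) (by
        simp [key, k04, k03, k14, k13, o, o', hne2])
end IsPlaneColoring

theorem Set.add_le_encard_of_disjoint {K : Type*} {C X S : Set K} {a b : ℕ∞} (hX : X ⊆ C)
    (hS : S ⊆ C) (hd : Disjoint X S) (ha : a ≤ X.encard) (hb : b ≤ S.encard) :
    a + b ≤ C.encard :=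
  calc a + b ≤ X.encard + S.encard := add_le_add ha hb
    _ = (X ∪ S).encard := (Set.encard_union_eq hd).symm
    _ ≤ C.encard := Set.encard_le_encard (Set.union_subset hX hS)

namespace IsPlaneColoring

variable {V K F L M : Type*} [Field F] [LinearOrder L] [OrderTop L] [LinearOrder M] [OrderTop M]
  {c : V → V → K} {t y : V → F} {lam : K → L} {kap : K → K → M}

/-- Five points whose tree separates `a₀, a₁, a₂` from `a₃, a₄` and then splits off `a₂`. -/
theorem six_colors_triple_pair (h : IsPlaneColoring c t y lam kap) {a₀ a₁ a₂ a₃ a₄ : V}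
    (d01 : a₀ ≠ a₁) (d02 : a₀ ≠ a₂) (d03 : a₀ ≠ a₃) (d04 : a₀ ≠ a₄) (d12 : a₁ ≠ a₂)
    (d13 : a₁ ≠ a₃) (d14 : a₁ ≠ a₄) (d23 : a₂ ≠ a₃) (d24 : a₂ ≠ a₄) (d34 : a₃ ≠ a₄) {C : Set K}
    (C01 : c a₀ a₁ ∈ C) (C02 : c a₀ a₂ ∈ C) (C03 : c a₀ a₃ ∈ C) (C04 : c a₀ a₄ ∈ C)
    (C12 : c a₁ a₂ ∈ C) (C13 : c a₁ a₃ ∈ C) (C14 : c a₁ a₄ ∈ C)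
    (C23 : c a₂ a₃ ∈ C) (C24 : c a₂ a₄ ∈ C) (C34 : c a₃ a₄ ∈ C)
    {m₀ m₁ : L} (l03 : lam (c a₀ a₃) = m₀) (l04 : lam (c a₀ a₄) = m₀)
    (l13 : lam (c a₁ a₃) = m₀) (l14 : lam (c a₁ a₄) = m₀) (l23 : lam (c a₂ a₃) = m₀)
    (l24 : lam (c a₂ a₄) = m₀) (l02 : lam (c a₀ a₂) = m₁) (l12 : lam (c a₁ a₂) = m₁)
    (hm01 : m₀ < m₁) (hm1 : m₁ < lam (c a₀ a₁)) (hm34 : m₀ < lam (c a₃ a₄)) :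
    6 ≤ C.encard := by
  have key {k k' : K} (hk : lam k ≠ lam k') : k ≠ k' := fun e => hk (e ▸ rfl)
  set S : Set K := {c a₀ a₃, c a₀ a₄, c a₁ a₃, c a₁ a₄, c a₂ a₃, c a₂ a₄} with hS
  have hSC : S ⊆ C := by rintro k (rfl | rfl | rfl | rfl | rfl | rfl) <;> assumption
  have hSl : ∀ k ∈ S, lam k = m₀ := by rintro k (rfl | rfl | rfl | rfl | rfl | rfl) <;> assumption
  have dis {X : Set K} (hX : ∀ k ∈ X, m₀ < lam k) : Disjoint X S :=
    Set.disjoint_left.2 fun k h1 h2 => (hX k h1).ne' (hSl k h2)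
  have l01 : m₀ < lam (c a₀ a₁) := hm01.trans hm1
  have l02' : m₀ < lam (c a₀ a₂) := l02.symm ▸ hm01
  have l12' : m₀ < lam (c a₁ a₂) := l12.symm ▸ hm01
  have n02 : c a₀ a₁ ≠ c a₀ a₂ := key (by rw [l02]; exact hm1.ne')
  have n12 : c a₀ a₁ ≠ c a₁ a₂ := key (by rw [l12]; exact hm1.ne')
  have three {k₁ k₂ k₃ : K} (h12 : k₁ ≠ k₂) (h13 : k₁ ≠ k₃) (h23 : k₂ ≠ k₃) (h1 : k₁ ∈ C)
      (h2 : k₂ ∈ C) (h3 : k₃ ∈ C) (l1 : m₀ < lam k₁) (l2 : m₀ < lam k₂) (l3 : m₀ < lam k₃)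
      (h4 : 3 ≤ S.encard) : 6 ≤ C.encard := by
    have := Set.add_le_encard_of_disjoint (X := {k₁, k₂, k₃}) (a := 3) (C := C)
      (by rintro k (rfl | rfl | rfl) <;> assumption) hSC
      (dis (by rintro k (rfl | rfl | rfl) <;> assumption))
      (Set.encard_eq_three.2 ⟨_, _, _, h12, h13, h23, rfl⟩).ge h4
    exact this
  have two {k₁ k₂ : K} (h12 : k₁ ≠ k₂) (h1 : k₁ ∈ C)
      (h2 : k₂ ∈ C) (l1 : m₀ < lam k₁) (l2 : m₀ < lam k₂)
      (h4 : 4 ≤ S.encard) : 6 ≤ C.encard := by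
    have := Set.add_le_encard_of_disjoint (X := {k₁, k₂}) (a := 2) (C := C)
      (by rintro k (rfl | rfl) <;> assumption) hSC
      (dis (by rintro k (rfl | rfl) <;> assumption))
      (Set.encard_eq_two.2 ⟨_, _, h12, rfl⟩).ge h4
    exact this
  have s := h.symm
  have swap {k₁ k₂ k₃ k₄ k₅ k₆ : K} :
      ({k₁, k₂, k₃, k₄, k₅, k₆} : Set K) = {k₂, k₁, k₄, k₃, k₆, k₅} := by
    rw [Set.insert_comm k₁, Set.insert_comm k₃, Set.pair_comm k₅]
  have perm {k₁ k₂ k₃ k₄ k₅ k₆ : K} :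
      ({k₁, k₂, k₃, k₄, k₅, k₆} : Set K) = {k₁, k₂, k₅, k₆, k₃, k₄} := by
    ext; simp only [Set.mem_insert_iff, Set.mem_singleton_iff]; grind
  have perm' {k₁ k₂ k₃ k₄ k₅ k₆ : K} :
      ({k₁, k₂, k₃, k₄, k₅, k₆} : Set K) = {k₃, k₄, k₅, k₆, k₁, k₂} := by
    ext; simp only [Set.mem_insert_iff, Set.mem_singleton_iff]; grind
  -- The cross edges have depth `m₀` and share no colour with the edges inside the triple and the
  -- pair. The cases split six as 2 + 4, 3 + 3 or 4 + 2, inner colours first.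
  by_cases e : c a₀ a₂ = c a₁ a₂
  · have e' : c a₂ a₀ = c a₂ a₁ := by rw [s a₂, s a₂, e]
    by_cases e1 : c a₀ a₁ = c a₃ a₄
    · refine two n02 C01 C02 l01 l02' ?_
      rcases h.kap_pair d01 e1 with ⟨k1, k2⟩ | ⟨k1, k2⟩
      · exact h.four_le_cross_of_base d01 d23 d24 d34 e' e1 k1 k2
      · have := h.four_le_cross_of_base d01 d24 d23 d34.symm e' (e1.trans (s a₃ a₄)) k1 k2
        rwa [hS, swap]
    by_cases e2 : c a₀ a₂ = c a₃ a₄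
    · refine two n02 C01 C02 l01 l02' ?_
      rcases h.kap_pair d02 e2 with ⟨k1, k2⟩ | ⟨k1, k2⟩
      · have := h.four_le_cross_of_leg d01 d02 d12 d03 d13 d23 e' (e2.trans (s a₃ a₄)) k1 k2
        rwa [hS, swap]
      · exact h.four_le_cross_of_leg d01 d02 d12 d04 d14 d24 e' e2 k1 k2
    · exact three n02 e1 e2 C01 C02 C34 l01 l02' hm34
        (h.three_le_cross_of_cherry d01 d02 d12 d03 d04 d13 d14 d23 d24 d34 e')
  · have T := three n02 n12 e C01 C02 C12 l01 l02' l12'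
    by_cases e1 : c a₀ a₁ = c a₃ a₄
    · exact T (h.three_le_cross_of_eq d01 d02 d12 d34 e1)
    by_cases e2 : c a₀ a₂ = c a₃ a₄
    · refine T ?_
      rw [hS, perm]
      exact h.three_le_cross_of_eq d02 d01 d12.symm d34 e2
    by_cases e3 : c a₁ a₂ = c a₃ a₄
    · refine T ?_
      rw [hS, perm']
      exact h.three_le_cross_of_eq d12 d01.symm d02.symm d34 e3
    have : 2 ≤ S.encard := by
      by_contra h2
      have h1 : S.encard ≤ 1 := Order.le_of_lt_add_one (by simpa [one_add_one_eq_two] using h2)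
      rw [Set.encard_le_one_iff] at h1
      exact h.four_cycle d01 d34 (h1 _ _ (by simp [hS]) (by simp [hS]))
        (h1 _ _ (by simp [hS]) (by simp [hS])) (h1 _ _ (by simp [hS]) (by simp [hS]))
    have := Set.add_le_encard_of_disjoint (X := {c a₀ a₁, c a₀ a₂, c a₁ a₂, c a₃ a₄}) (a := 4)
      (C := C) (by rintro k (rfl | rfl | rfl | rfl) <;> assumption) hSC
      (dis (by rintro k (rfl | rfl | rfl | rfl) <;> assumption))
      (four_le (k₁ := c a₀ a₁) (k₂ := c a₀ a₂) (k₃ := c a₁ a₂) (k₄ := c a₃ a₄) (by simp) (by simp)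
        (by simp) (by simp) (by simp [n02, n12, e, e1, e2, e3])) this
    exact this
end IsPlaneColoring

/-! ### The tree of five points -/

/-- Every finite set of at least two points splits at its least distance. -/
theorem IsBinaryUltrametric.exists_split {V L : Type*} [LinearOrder L] [OrderTop L]
    [DecidableEq V] {D : V → V → L} (h : IsBinaryUltrametric D) (hD : ∀ x y, x ≠ y → D x y ≠ ⊤)
    {S : Finset V} (hS : 2 ≤ S.card) :
    ∃ (m : L) (A B : Finset V), 1 ≤ A.card ∧ A.card ≤ B.card ∧ A.card + B.card = S.card ∧
      A ∪ B = S ∧ (∀ x ∈ A, ∀ y ∈ B, x ≠ y) ∧ (∀ x ∈ A, ∀ y ∈ B, D x y = m) ∧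
      (∀ x ∈ A, ∀ y ∈ A, m < D x y) ∧ (∀ x ∈ B, ∀ y ∈ B, m < D x y) := by
  obtain ⟨p, hp, hmin⟩ := S.offDiag.exists_min_image (fun p => D p.1 p.2) (by
    obtain ⟨a, ha, b, hb, hab⟩ := Finset.one_lt_card.1 hS
    exact ⟨(a, b), by simp [*]⟩)
  obtain ⟨a, b⟩ := p
  simp only [Finset.mem_offDiag, ne_eq, and_imp, Prod.forall] at hp hmin
  obtain ⟨ha, hb, hab⟩ := hp
  set m := D a b with hm
  have hm' : m < ⊤ := (hD a b hab).lt_top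
  -- `A` is the ball around `a` of points beyond the least distance. All other points are at
  -- distance exactly `m` from `a`, hence further than `m` from each other because the ultrametric
  -- is binary.
  set A := S.filter fun x => m < D a x with hA
  set B := S.filter fun x => ¬ m < D a x with hB
  have memA {x} : x ∈ A ↔ x ∈ S ∧ m < D a x := by simp [hA]
  have memB {x} : x ∈ B → D a x = m := fun hx => by
    simp only [hB, Finset.mem_filter, not_lt] at hx
    refine le_antisymm hx.2 (hmin a x ha hx.1 ?_)
    rintro rfl
    rw [h.self] at hx
    exact absurd hx.2 (not_le.2 hm')
  have haA : a ∈ A := memA.2 ⟨ha, by rwa [h.self]⟩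
  have hbB : b ∈ B := by simp [hB, hb, hm]
  have hdis : ∀ x ∈ A, ∀ y ∈ B, x ≠ y := by
    rintro x hx y hy rfl
    exact (memA.1 hx).2.ne' (memB hy)
  have hcard : A.card + B.card = S.card := Finset.card_filter_add_card_filter_not _
  have hun : A ∪ B = S := Finset.filter_union_filter_not_eq _ _
  have cross : ∀ x ∈ A, ∀ y ∈ B, D x y = m := by
    intro x hx y hy
    have h1 := (memA.1 hx).2
    have h2 := memB hy
    rcases h.triangle x a y with t | t | t | t <;> rw [h.symm x a] at t <;> grind
  have inA : ∀ x ∈ A, ∀ y ∈ A, m < D x y := by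
    intro x hx y hy
    have h1 := (memA.1 hx).2
    have h2 := (memA.1 hy).2
    rcases h.triangle x a y with t | t | t | t <;> rw [h.symm x a] at t <;> grind
  have inB : ∀ x ∈ B, ∀ y ∈ B, m < D x y := by
    intro x hx y hy
    have h1 := memB hx
    have h2 := memB hy
    rcases h.triangle x a y with t | t | t | t <;> rw [h.symm x a] at t <;> grind
  rcases le_total A.card B.card with hle | hle
  · exact ⟨m, A, B, Finset.card_pos.2 ⟨a, haA⟩, hle, hcard, hun, hdis, cross, inA, inB⟩
  · exact ⟨m, B, A, Finset.card_pos.2 ⟨b, hbB⟩, hle, by omega, by rw [Finset.union_comm, hun],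
      fun x hx y hy => (hdis y hy x hx).symm, fun x hx y hy => by rw [h.symm, cross y hy x hx],
      inB, inA⟩

namespace IsPlaneColoring

variable {V K F L M : Type*} [Field F] [LinearOrder L] [OrderTop L] [LinearOrder M] [OrderTop M]
  {c : V → V → K} {t y : V → F} {lam : K → L} {kap : K → K → M}

/-- Any five points receive at least six colours. -/
theorem six_colors (h : IsPlaneColoring c t y lam kap) {S : Finset V} (hS : S.card = 5) :
    6 ≤ {k : K | ∃ x ∈ S, ∃ y ∈ S, x ≠ y ∧ c x y = k}.encard := by
  classical
  set C := {k : K | ∃ x ∈ S, ∃ y ∈ S, x ≠ y ∧ c x y = k}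
  have mem {x y} (hx : x ∈ S) (hy : y ∈ S) (hxy : x ≠ y) : c x y ∈ C := ⟨x, hx, y, hy, hxy, rfl⟩
  have split {T : Finset V} (hT : 2 ≤ T.card) := h.lam_ultra.exists_split (S := T)
    (fun x y hxy => h.lam_ne hxy) hT
  clear_value C
  obtain ⟨m, A, B, c1, c2, c3, rfl, n, f1, f2, f3⟩ := split (T := S) (by omega)
  rcases (show A.card = 1 ∨ A.card = 2 by omega) with hA | hA
  · obtain ⟨a₀, rfl⟩ := Finset.card_eq_one.1 hA
    obtain ⟨m', A, B, c1', c2', c3', rfl, n', f1', f2', f3'⟩ := split (T := B) (by omega)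
    rcases (show A.card = 1 ∨ A.card = 2 by omega) with hA' | hA'
    · obtain ⟨a₁, rfl⟩ := Finset.card_eq_one.1 hA'
      obtain ⟨m'', A, B, c1'', c2'', c3'', rfl, n'', f1'', f2'', f3''⟩ := split (T := B) (by omega)
      obtain ⟨a₂, rfl⟩ := Finset.card_eq_one.1 (show A.card = 1 by omega)
      obtain ⟨a₃, a₄, d34, rfl⟩ := Finset.card_eq_two.1 (show B.card = 2 by omega)
      have d01 : a₀ ≠ a₁ := n _ (by simp) _ (by simp)
      have d02 : a₀ ≠ a₂ := n _ (by simp) _ (by simp)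
      have d03 : a₀ ≠ a₃ := n _ (by simp) _ (by simp)
      have d04 : a₀ ≠ a₄ := n _ (by simp) _ (by simp)
      have d12 : a₁ ≠ a₂ := n' _ (by simp) _ (by simp)
      have d13 : a₁ ≠ a₃ := n' _ (by simp) _ (by simp)
      have d14 : a₁ ≠ a₄ := n' _ (by simp) _ (by simp)
      have d23 : a₂ ≠ a₃ := n'' _ (by simp) _ (by simp)
      have d24 : a₂ ≠ a₄ := n'' _ (by simp) _ (by simp)
      have hm : m < m' := f1' a₁ (by simp) a₂ (by simp) ▸ f3 a₁ (by simp) a₂ (by simp)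
      have hm' : m' < m'' := f1'' a₂ (by simp) a₃ (by simp) ▸ f3' a₂ (by simp) a₃ (by simp)
      exact h.six_colors_caterpillar d34
        (mem (by simp) (by simp) d01) (mem (by simp) (by simp) d02)
        (mem (by simp) (by simp) d03) (mem (by simp) (by simp) d04)
        (mem (by simp) (by simp) d12) (mem (by simp) (by simp) d13)
        (mem (by simp) (by simp) d14) (mem (by simp) (by simp) d23)
        (mem (by simp) (by simp) d24) (mem (by simp) (by simp) d34)
        (f1 _ (by simp) _ (by simp)) (f1 _ (by simp) _ (by simp)) (f1 _ (by simp) _ (by simp))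
        (f1 _ (by simp) _ (by simp)) (f1' _ (by simp) _ (by simp)) (f1' _ (by simp) _ (by simp))
        (f1' _ (by simp) _ (by simp)) (f1'' _ (by simp) _ (by simp)) (f1'' _ (by simp) _ (by simp))
        hm hm' (f3'' _ (by simp) _ (by simp))
    · obtain ⟨a₁, a₂, d12, rfl⟩ := Finset.card_eq_two.1 hA'
      obtain ⟨a₃, a₄, d34, rfl⟩ := Finset.card_eq_two.1 (show B.card = 2 by omega)
      have d01 : a₀ ≠ a₁ := n _ (by simp) _ (by simp)
      have d02 : a₀ ≠ a₂ := n _ (by simp) _ (by simp)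
      have d03 : a₀ ≠ a₃ := n _ (by simp) _ (by simp)
      have d04 : a₀ ≠ a₄ := n _ (by simp) _ (by simp)
      have d13 : a₁ ≠ a₃ := n' _ (by simp) _ (by simp)
      have d14 : a₁ ≠ a₄ := n' _ (by simp) _ (by simp)
      have d23 : a₂ ≠ a₃ := n' _ (by simp) _ (by simp)
      have d24 : a₂ ≠ a₄ := n' _ (by simp) _ (by simp)
      have hm : m < m' := f1' a₁ (by simp) a₃ (by simp) ▸ f3 a₁ (by simp) a₃ (by simp)
      exact h.six_colors_balanced d02 d03 d04 d12 d13 d14 d23 d24 d34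
        (mem (by simp) (by simp) d01) (mem (by simp) (by simp) d02)
        (mem (by simp) (by simp) d03) (mem (by simp) (by simp) d04)
        (mem (by simp) (by simp) d12) (mem (by simp) (by simp) d13)
        (mem (by simp) (by simp) d14) (mem (by simp) (by simp) d23)
        (mem (by simp) (by simp) d24) (mem (by simp) (by simp) d34)
        (f1 _ (by simp) _ (by simp)) (f1 _ (by simp) _ (by simp)) (f1 _ (by simp) _ (by simp))
        (f1 _ (by simp) _ (by simp)) (f1' _ (by simp) _ (by simp)) (f1' _ (by simp) _ (by simp))
        (f1' _ (by simp) _ (by simp)) (f1' _ (by simp) _ (by simp)) hm (f2' _ (by simp) _ (by simp))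
        (f3' _ (by simp) _ (by simp))
  · obtain ⟨a₃, a₄, d34, rfl⟩ := Finset.card_eq_two.1 hA
    obtain ⟨m', A, B, c1', c2', c3', rfl, n', f1', f2', f3'⟩ := split (T := B) (by omega)
    obtain ⟨a₂, rfl⟩ := Finset.card_eq_one.1 (show A.card = 1 by omega)
    obtain ⟨a₀, a₁, d01, rfl⟩ := Finset.card_eq_two.1 (show B.card = 2 by omega)
    have d03 : a₀ ≠ a₃ := (n _ (by simp) _ (by simp)).symm
    have d04 : a₀ ≠ a₄ := (n _ (by simp) _ (by simp)).symm
    have d13 : a₁ ≠ a₃ := (n _ (by simp) _ (by simp)).symm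
    have d14 : a₁ ≠ a₄ := (n _ (by simp) _ (by simp)).symm
    have d23 : a₂ ≠ a₃ := (n _ (by simp) _ (by simp)).symm
    have d24 : a₂ ≠ a₄ := (n _ (by simp) _ (by simp)).symm
    have d02 : a₀ ≠ a₂ := (n' _ (by simp) _ (by simp)).symm
    have d12 : a₁ ≠ a₂ := (n' _ (by simp) _ (by simp)).symm
    have hm : m < m' := f1' a₂ (by simp) a₀ (by simp) ▸ f3 a₂ (by simp) a₀ (by simp)
    have s := h.symm
    exact h.six_colors_triple_pair d01 d02 d03 d04 d12 d13 d14 d23 d24 d34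
      (mem (by simp) (by simp) d01) (mem (by simp) (by simp) d02)
      (mem (by simp) (by simp) d03) (mem (by simp) (by simp) d04)
      (mem (by simp) (by simp) d12) (mem (by simp) (by simp) d13)
      (mem (by simp) (by simp) d14) (mem (by simp) (by simp) d23)
      (mem (by simp) (by simp) d24) (mem (by simp) (by simp) d34)
      (s _ _ ▸ f1 _ (by simp) _ (by simp))
      (s _ _ ▸ f1 _ (by simp) _ (by simp))
      (s _ _ ▸ f1 _ (by simp) _ (by simp))
      (s _ _ ▸ f1 _ (by simp) _ (by simp))
      (s _ _ ▸ f1 _ (by simp) _ (by simp))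
      (s _ _ ▸ f1 _ (by simp) _ (by simp))
      (s _ _ ▸ f1' _ (by simp) _ (by simp))
      (s _ _ ▸ f1' _ (by simp) _ (by simp))
      hm (f3' _ (by simp) _ (by simp))
      (f2 _ (by simp) _ (by simp))

end IsPlaneColoring

/-! ### First differences of binary words -/

/-- The first position at which two words differ. -/
def firstDiff {ι : Type*} [Fintype ι] [LinearOrder ι] (f g : ι → Bool) : WithTop ι :=
  (Finset.univ.filter fun r => f r ≠ g r).min

section firstDiff

variable {ι : Type*} [Fintype ι] [LinearOrder ι] {f g : ι → Bool}

theorem firstDiff_eq_top : firstDiff f g = ⊤ ↔ f = g := by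
  simp [firstDiff, Finset.min_eq_top, Finset.filter_eq_empty_iff, funext_iff]

theorem firstDiff_self : firstDiff f f = ⊤ := firstDiff_eq_top.2 rfl

theorem firstDiff_comm (f g : ι → Bool) : firstDiff f g = firstDiff g f := by
  simp only [firstDiff, ne_comm]

theorem lt_firstDiff {r : ι} : r < firstDiff f g ↔ ∀ s ≤ r, f s = g s := by
  rw [firstDiff, Finset.min, Finset.lt_inf_iff (WithTop.coe_lt_top r)]
  simp only [Finset.mem_filter, Finset.mem_univ, true_and, Function.comp_apply, WithTop.coe_lt_coe]
  constructor
  · intro h s hs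
    by_contra hne
    exact absurd (h s hne) (not_lt.2 hs)
  · intro h s hne
    by_contra hs
    exact hne (h s (not_lt.1 hs))

theorem firstDiff_eq_coe {r : ι} : firstDiff f g = r ↔ f r ≠ g r ∧ ∀ s < r, f s = g s := by
  constructor
  · intro h
    refine ⟨(Finset.mem_filter.1 (Finset.mem_of_min h)).2, fun s hs => ?_⟩
    exact lt_firstDiff.1 (h ▸ WithTop.coe_lt_coe.2 hs : (s : WithTop ι) < firstDiff f g) s le_rfl
  · rintro ⟨h1, h2⟩
    refine le_antisymm (Finset.min_le (by simp [h1])) (Finset.le_min fun s hs => ?_)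
    refine WithTop.coe_le_coe.2 (le_of_not_gt fun h3 => ?_)
    exact (Finset.mem_filter.1 hs).2 (h2 s h3)

theorem firstDiff_of_lt {f g k : ι → Bool} (h : firstDiff f g < firstDiff g k) :
    firstDiff f k = firstDiff f g := by
  obtain ⟨r, hr⟩ := WithTop.ne_top_iff_exists.1 h.ne_top
  rw [← hr] at h ⊢
  obtain ⟨h1, h2⟩ := firstDiff_eq_coe.1 hr.symm
  have h3 := lt_firstDiff.1 h
  exact firstDiff_eq_coe.2 ⟨h3 r le_rfl ▸ h1, fun s hs => (h2 s hs).trans (h3 s hs.le)⟩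

/-- The alphabet has two letters: if `x, y` and `y, z` first differ at the same position, then `x`
and `z` agree there. -/
theorem isBinaryUltrametric_firstDiff {V : Type*} (w : V → ι → Bool) :
    IsBinaryUltrametric fun a b => firstDiff (w a) (w b) where
  self _ := firstDiff_self
  symm _ _ := firstDiff_comm _ _
  triangle x y z := by
    rcases lt_trichotomy (firstDiff (w x) (w y)) (firstDiff (w y) (w z)) with h | h | h
    · exact .inr (.inr (.inl ⟨(firstDiff_of_lt h).symm, h⟩))
    · by_cases ht : firstDiff (w x) (w y) = ⊤
      · have h1 := firstDiff_eq_top.1 ht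
        exact .inl ⟨ht, h ▸ ht, by rw [h1, ← h, ht]⟩
      · obtain ⟨r, hr⟩ := WithTop.ne_top_iff_exists.1 ht
        obtain ⟨h1, h2⟩ := firstDiff_eq_coe.1 hr.symm
        obtain ⟨h3, h4⟩ := firstDiff_eq_coe.1 (h ▸ hr.symm)
        refine .inr (.inl ⟨h, ?_⟩)
        rw [← hr]
        refine lt_firstDiff.2 fun s hs => ?_
        rcases hs.eq_or_lt with rfl | hs
        · revert h1 h3
          cases w x s <;> cases w y s <;> cases w z s <;> simp
        · exact (h2 s hs).trans (h4 s hs)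
    · refine .inr (.inr (.inr ?_))
      have h' : firstDiff (w z) (w y) < firstDiff (w y) (w x) := by
        rwa [firstDiff_comm (w z), firstDiff_comm (w y) (w x)]
      have := firstDiff_of_lt h'
      rw [firstDiff_comm, firstDiff_comm (w z)] at this
      exact ⟨this, this ▸ h⟩

end firstDiff

/-! ### The explicit colouring -/

namespace PlaneColoring

variable {p T b : ℕ}

/-- The colours: the first difference, the first difference in each block, the pair of words in
the block of the first difference, the value of the quadratic form, and two bits. -/
abbrev Color (p T b : ℕ) : Type :=
  WithTop (Fin T ×ₗ Fin b) × (Fin T → WithTop (Fin b)) × (Fin b → Bool) × (Fin b → Bool) × ZMod p ×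
    Bool × Bool

/-- The block containing a position, read off a word. -/
def block (f : Fin T ×ₗ Fin b → Bool) : WithTop (Fin T ×ₗ Fin b) → Fin b → Bool
  | ⊤ => fun _ => false
  | (r : Fin T ×ₗ Fin b) => fun j => f (toLex ((ofLex r).1, j))

/-- The colour of an ordered pair. -/
def orderedColor (w : ZMod p × ZMod p → Fin T ×ₗ Fin b → Bool) (u v : ZMod p × ZMod p) :
    Color p T b :=
  (firstDiff (w u) (w v),
    fun i => firstDiff (fun j => w u (toLex (i, j))) (fun j => w v (toLex (i, j))),
    block (w u) (firstDiff (w u) (w v)), block (w v) (firstDiff (w u) (w v)),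
    u.1 * v.1 + u.2 + v.2, decide (u.1 = v.1), decide ((v.1 - u.1).val ≤ p / 2))

/-- The word of `u` is lexicographically before that of `v`. -/
def Before (w : ZMod p × ZMod p → Fin T ×ₗ Fin b → Bool) (u v : ZMod p × ZMod p) : Prop :=
  ∃ r : Fin T ×ₗ Fin b, firstDiff (w u) (w v) = r ∧ w u r = false

open Classical in
/-- The colour of an unordered pair. -/
noncomputable def color (w : ZMod p × ZMod p → Fin T ×ₗ Fin b → Bool) (u v : ZMod p × ZMod p) :
    Color p T b :=
  if Before w u v then orderedColor w u v else orderedColor w v u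

variable {w : ZMod p × ZMod p → Fin T ×ₗ Fin b → Bool}

theorem color_fst (u v : ZMod p × ZMod p) : (color w u v).1 = firstDiff (w u) (w v) := by
  unfold color orderedColor
  split_ifs
  · rfl
  · exact firstDiff_comm _ _

theorem color_snd_fst (u v : ZMod p × ZMod p) (i : Fin T) : (color w u v).2.1 i =
    firstDiff (fun j => w u (toLex (i, j))) (fun j => w v (toLex (i, j))) := by
  unfold color orderedColor
  split_ifs
  · rfl
  · exact firstDiff_comm (ι := Fin b) _ _

theorem color_form (u v : ZMod p × ZMod p) :
    (color w u v).2.2.2.2.1 = u.1 * v.1 + u.2 + v.2 := by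
  unfold color orderedColor
  split_ifs
  · rfl
  · dsimp only; ring

theorem color_bit (u v : ZMod p × ZMod p) :
    (color w u v).2.2.2.2.2.1 = decide (u.1 = v.1) := by
  unfold color orderedColor
  split_ifs
  · rfl
  · simp only [eq_comm]

theorem before_iff {u v : ZMod p × ZMod p} {r : Fin T ×ₗ Fin b}
    (h : firstDiff (w u) (w v) = r) : Before w u v ↔ w u r = false := by
  constructor
  · rintro ⟨r', h1, h2⟩
    rw [h, WithTop.coe_inj] at h1
    rwa [h1]
  · exact fun h2 => ⟨r, h, h2⟩

/-- The letters at the first difference are distinct, so exactly one of the two orders of a pair of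
distinct points is `Before`. -/
theorem color_comm (hw : Function.Injective w) (u v : ZMod p × ZMod p) :
    color w u v = color w v u := by
  by_cases h : firstDiff (w u) (w v) = ⊤
  · rw [hw (firstDiff_eq_top.1 h)]
  · obtain ⟨r, hr⟩ := WithTop.ne_top_iff_exists.1 h
    have h1 := before_iff hr.symm
    have h2 := before_iff (hr.trans (firstDiff_comm _ _)).symm
    have h3 := (firstDiff_eq_coe.1 hr.symm).1
    classical
    unfold color
    rw [if_congr h1 rfl rfl, if_congr h2 rfl rfl]
    cases hu : w u r <;> cases hv : w v r <;> simp_all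

/-- The block index of the first difference recorded in a colour. -/
def blockDiff (k k' : Color p T b) : WithTop (Fin b) :=
  match k.1 with
  | ⊤ => ⊤
  | (r : Fin T ×ₗ Fin b) => k'.2.1 (ofLex r).1

theorem blockDiff_eq {k : Color p T b} {r : Fin T ×ₗ Fin b} (hk : k.1 = r)
    (u v : ZMod p × ZMod p) : blockDiff k (color w u v) =
      firstDiff (fun j => w u (toLex ((ofLex r).1, j)))
        (fun j => w v (toLex ((ofLex r).1, j))) := by
  rw [← color_snd_fst]
  unfold blockDiff
  rw [hk]

theorem color_blocks (u v : ZMod p × ZMod p) :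
    ((color w u v).2.2.1 = block (w u) (color w u v).1 ∧
      (color w u v).2.2.2.1 = block (w v) (color w u v).1) ∨
    ((color w u v).2.2.1 = block (w v) (color w u v).1 ∧
      (color w u v).2.2.2.1 = block (w u) (color w u v).1) := by
  rw [color_fst]
  unfold color orderedColor
  split_ifs
  · exact .inl ⟨rfl, rfl⟩
  · dsimp only
    rw [firstDiff_comm (w v) (w u)]
    exact .inr ⟨rfl, rfl⟩

/-- For `d ≠ 0` the representatives of `d` and `-d` sum to the odd number `p`, so exactly one of
them lies in the lower half. -/
theorem half_neg [Fact p.Prime] (hp : p ≠ 2) {d : ZMod p}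
    (h : decide (d.val ≤ p / 2) = decide ((-d).val ≤ p / 2)) : d = 0 := by
  by_contra hd
  have : NeZero d := ⟨hd⟩
  rw [ZMod.val_neg_of_ne_zero, decide_eq_decide] at h
  have h1 := ZMod.val_lt d
  have h2 := (Fact.out : p.Prime).eq_two_or_odd
  omega

theorem isPlaneColoring [Fact p.Prime] (hp : p ≠ 2) (hw : Function.Injective w) :
    IsPlaneColoring (color w) Prod.fst Prod.snd Prod.fst blockDiff where
  two_ne := by
    intro h
    have h2 := (ZMod.natCast_eq_zero_iff 2 p).1 (by exact_mod_cast h)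
    exact hp ((Nat.prime_dvd_prime_iff_eq Fact.out Nat.prime_two).1 h2)
  symm := color_comm hw
  inj _ _ := Prod.ext
  form {a b d e} h := by rw [← color_form (w := w), h, color_form]
  eq_iff {a b d e} h := by
    have : decide (a.1 = b.1) = decide (d.1 = e.1) := by rw [← color_bit (w := w), h, color_bit]
    simpa using this
  -- Equal colours put both first differences with `z` at one position, and the letter of `z` there
  -- orients both edges the same way. The orientation bits thus compare a difference of first
  -- coordinates with its negative.
  sign {z a b} hza hzb h ht := by
    have hne : firstDiff (w z) (w a) ≠ ⊤ := fun h => hza (hw (firstDiff_eq_top.1 h))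
    obtain ⟨r, hr⟩ := WithTop.ne_top_iff_exists.1 hne
    have hr' : firstDiff (w z) (w b) = r := by rw [← color_fst, ← h, color_fst, hr]
    have h1 := before_iff hr.symm
    have h2 := before_iff hr'
    have hd : b.1 - z.1 = -(a.1 - z.1) := by linear_combination ht
    have hd' : z.1 - b.1 = -(z.1 - a.1) := by linear_combination -ht
    unfold color at h
    rw [← sub_eq_zero]
    by_cases hz : w z r = false
    · rw [if_pos (h1.2 hz), if_pos (h2.2 hz)] at h
      have := congrArg (fun k : Color p T _ => k.2.2.2.2.2.2) h
      simp only [orderedColor] at this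
      rw [hd] at this
      exact half_neg hp this
    · rw [if_neg (fun h => hz (h1.1 h)), if_neg (fun h => hz (h2.1 h))] at h
      have := congrArg (fun k : Color p T _ => k.2.2.2.2.2.2) h
      simp only [orderedColor] at this
      rw [hd'] at this
      have := half_neg hp this
      linear_combination -this
  lam_ultra := by simpa only [color_fst] using isBinaryUltrametric_firstDiff w
  lam_ne {a b} hab h := by
    rw [color_fst] at h
    exact hab (hw (firstDiff_eq_top.1 h))
  kap_ultra k := by
    by_cases hk : k.1 = ⊤
    · have : (fun u v => blockDiff k (color w u v)) = fun _ _ => ⊤ := by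
        funext u v
        unfold blockDiff
        rw [hk]
      rw [this]
      exact ⟨fun _ => rfl, fun _ _ => rfl, fun _ _ _ => .inl ⟨rfl, rfl, rfl⟩⟩
    · obtain ⟨r, hr⟩ := WithTop.ne_top_iff_exists.1 hk
      simpa only [blockDiff_eq hr.symm] using isBinaryUltrametric_firstDiff
        fun u j => w u (toLex ((ofLex r).1, j))
  kap_ne {u v} huv h := by
    have hne : firstDiff (w u) (w v) ≠ ⊤ := fun h => huv (hw (firstDiff_eq_top.1 h))
    obtain ⟨r, hr⟩ := WithTop.ne_top_iff_exists.1 hne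
    rw [blockDiff_eq ((color_fst u v).trans hr.symm), firstDiff_eq_top] at h
    exact (firstDiff_eq_coe.1 hr.symm).1 (congrFun h (ofLex r).2)
  kap_pair {u v u' v'} huv h := by
    have hne : firstDiff (w u) (w v) ≠ ⊤ := fun h => huv (hw (firstDiff_eq_top.1 h))
    obtain ⟨r, hr⟩ := WithTop.ne_top_iff_exists.1 hne
    have hk := (color_fst u v).trans hr.symm
    have b1 := color_blocks (w := w) u v
    have b2 := color_blocks (w := w) u' v'
    rw [← h] at b2
    rw [hk] at b1 b2
    -- The colour stores the words of both endpoints in the block of the first difference; only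
    -- which endpoint matches which stays open.
    simp only [blockDiff_eq hk, firstDiff_eq_top]
    change (block (w u) r = block (w u') r ∧ block (w v) r = block (w v') r) ∨
      (block (w u) r = block (w v') r ∧ block (w v) r = block (w u') r)
    rcases b1 with ⟨x, z⟩ | ⟨x, z⟩ <;> rcases b2 with ⟨x', z'⟩ | ⟨x', z'⟩ <;>
      rw [← x, ← z, ← x', ← z'] <;> simp

theorem card_color [NeZero p] : Fintype.card (Color p T b) =
    (T * b + 1) * ((b + 1) ^ T * (2 ^ b * (2 ^ b * (p * 4)))) := by
  have h1 : Fintype.card (WithTop (Fin T ×ₗ Fin b)) = T * b + 1 := by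
    rw [show Fintype.card (WithTop (Fin T ×ₗ Fin b)) = Fintype.card (Option (Fin T × Fin b)) from
      Fintype.card_congr (Equiv.refl _)]
    simp
  have h2 : Fintype.card (WithTop (Fin b)) = b + 1 := by
    rw [show Fintype.card (WithTop (Fin b)) = Fintype.card (Option (Fin b)) from
      Fintype.card_congr (Equiv.refl _)]
    simp
  simp only [Fintype.card_prod, Fintype.card_fun, Fintype.card_bool, ZMod.card, Fintype.card_fin,
    h1, h2]

end PlaneColoring

/-! ### Upper bound with free parameters -/

theorem erdosGyarfas_le_card {V K : Type*} [Fintype V] [Fintype K] {n q : ℕ} {c : V → V → K}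
    (hc : ∀ x y, c x y = c y x) {p : ℕ}
    (h : ∀ S : Finset V, S.card = p →
      q ≤ {k : K | ∃ x ∈ S, ∃ y ∈ S, x ≠ y ∧ c x y = k}.encard) (hn : n ≤ Fintype.card V) :
    erdosGyarfas n p q ≤ Fintype.card K := by
  obtain ⟨f⟩ : Nonempty (Fin n ↪ V) := Function.Embedding.nonempty_of_card_le (by simpa)
  let g := Fintype.equivFin K
  refine Nat.sInf_le ⟨.mk (fun x y _ => g (c (f x) (f y))) fun x y _ => by rw [hc], ?_⟩
  intro S hS
  have h1 := h (S.map f) (by simpa)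
  have h2 : {k : K | ∃ x ∈ S.map f, ∃ y ∈ S.map f, x ≠ y ∧ c x y = k}.encard ≤ _ :=
    (g.injective.encard_image _).ge
  rw [← Nat.cast_le (α := ℕ∞), Set.Finite.cast_ncard_eq (Set.toFinite _)]
  refine (h1.trans h2).trans (Set.encard_le_encard ?_)
  rintro _ ⟨_, ⟨x, hx, y, hy, hxy, rfl⟩, rfl⟩
  obtain ⟨x, hx, rfl⟩ := Finset.mem_map.1 hx
  obtain ⟨y, hy, rfl⟩ := Finset.mem_map.1 hy
  exact ⟨x, by simpa using hx, y, by simpa using hy, fun h => hxy (h ▸ rfl), rfl⟩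

theorem erdosGyarfas_five_six_le {n p T b : ℕ} [Fact p.Prime] (hp : p ≠ 2) (hn : n ≤ p ^ 2)
    (hb : p ^ 2 ≤ 2 ^ (T * b)) :
    erdosGyarfas n 5 6 ≤ (T * b + 1) * ((b + 1) ^ T * (2 ^ b * (2 ^ b * (p * 4)))) := by
  obtain ⟨w⟩ : Nonempty (ZMod p × ZMod p ↪ (Fin T ×ₗ Fin b → Bool)) :=
    Function.Embedding.nonempty_of_card_le (by
      have : Fintype.card (Fin T ×ₗ Fin b) = T * b := by
        rw [show Fintype.card (Fin T ×ₗ Fin b) = Fintype.card (Fin T × Fin b) from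
          Fintype.card_congr (Equiv.refl _)]
        simp
      simpa [ZMod.card, this, ← sq] using hb)
  rw [← PlaneColoring.card_color]
  refine erdosGyarfas_le_card (PlaneColoring.color_comm w.injective) (q := 6) (p := 5)
    (fun S hS => ?_) (by simpa [ZMod.card, ← sq] using hn)
  exact (PlaneColoring.isPlaneColoring hp w.injective).six_colors hS

/-! ### Counting cherries in a neighbourhood -/

section Counting

variable {V K : Type*} [DecidableEq V] [DecidableEq K]

/-- A symmetric function on pairs of elements of `N` such that the six pairs in any four elements
have at least five values other than `j`. -/
structure IsSpread (N : Finset V) (j : K) (c : V → V → K) : Prop where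
  symm : ∀ x y, c x y = c y x
  six_le : ∀ {u x y z}, u ∈ N → x ∈ N → y ∈ N → z ∈ N → u ≠ x → u ≠ y → u ≠ z → x ≠ y → x ≠ z →
    y ≠ z → ∀ T : Finset K, j ∈ T → c u x ∈ T → c u y ∈ T → c u z ∈ T → c x y ∈ T → c x z ∈ T →
      c y z ∈ T → 6 ≤ T.card
  four_le : 4 ≤ N.card

namespace IsSpread

variable {N : Finset V} {j : K} {c : V → V → K}

/-- The form in which `six_le` is applied: two independent coincidences among the seven entries
leave five colours that cover them all, which is impossible. -/
theorem not_covered (h : IsSpread N j c) {u x y z} (hu : u ∈ N) (hx : x ∈ N) (hy : y ∈ N)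
    (hz : z ∈ N) (hux : u ≠ x) (huy : u ≠ y) (huz : u ≠ z) (hxy : x ≠ y) (hxz : x ≠ z)
    (hyz : y ≠ z) (k₁ k₂ k₃ k₄ k₅ : K)
    (hk : ∀ k ∈ [j, c u x, c u y, c u z, c x y, c x z, c y z], k ∈ [k₁, k₂, k₃, k₄, k₅]) :
    False := by
  have h1 := h.six_le hu hx hy hz hux huy huz hxy hxz hyz [k₁, k₂, k₃, k₄, k₅].toFinset
  simp only [List.mem_toFinset] at h1
  have h2 := h1 (hk _ (by simp)) (hk _ (by simp)) (hk _ (by simp)) (hk _ (by simp))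
    (hk _ (by simp)) (hk _ (by simp)) (hk _ (by simp))
  have h3 := List.toFinset_card_le [k₁, k₂, k₃, k₄, k₅]
  simp only [List.length_cons, List.length_nil] at h3
  omega

theorem exists_fourth (h : IsSpread N j c) (u x y : V) : ∃ z ∈ N, u ≠ z ∧ x ≠ z ∧ y ≠ z := by
  obtain ⟨z, hz, hz'⟩ := Finset.exists_mem_notMem_of_card_lt_card
    (show ({u, x, y} : Finset V).card < N.card from Finset.card_le_three.trans_lt h.four_le)
  simp only [Finset.mem_insert, Finset.mem_singleton, not_or] at hz'
  exact ⟨z, hz, Ne.symm hz'.1, Ne.symm hz'.2.1, Ne.symm hz'.2.2⟩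

/-- No cherry has a base in its own colour or in the colour `j`. -/
theorem base_ne (h : IsSpread N j c) {u x y} (hu : u ∈ N) (hx : x ∈ N) (hy : y ∈ N)
    (hux : u ≠ x) (huy : u ≠ y) (hxy : x ≠ y) (e : c u x = c u y) : c x y ≠ c u x ∧ c x y ≠ j := by
  obtain ⟨z, hz, huz, hxz, hyz⟩ := h.exists_fourth u x y
  refine ⟨fun e' => ?_, fun e' => ?_⟩
  · exact h.not_covered hu hx hy hz hux huy huz hxy hxz hyz j (c u x) (c u z) (c x z) (c y z)
      (by simp [e', ← e])
  · exact h.not_covered hu hx hy hz hux huy huz hxy hxz hyz j (c u x) (c u z) (c x z) (c y z)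
      (by simp [e', ← e])

/-- The base of a cherry is an isolated edge. -/
theorem base_isolated (h : IsSpread N j c) {u x y z} (hu : u ∈ N) (hx : x ∈ N) (hy : y ∈ N)
    (hz : z ∈ N) (hux : u ≠ x) (huy : u ≠ y) (hxy : x ≠ y) (hxz : x ≠ z) (hyz : y ≠ z)
    (e : c u x = c u y) (e' : c x y = c x z) : False := by
  by_cases huz : u = z
  · subst huz
    exact (h.base_ne hu hx hy hux huy hxy e).1 (by rw [e', h.symm])
  · exact h.not_covered hu hx hy hz hux huy huz hxy hxz hyz j (c u x) (c u z) (c x y) (c y z)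
      (by simp [← e', ← e])

theorem base_unique (h : IsSpread N j c) {u v x y} (hu : u ∈ N) (hv : v ∈ N) (hx : x ∈ N)
    (hy : y ∈ N) (huv : u ≠ v) (hux : u ≠ x) (huy : u ≠ y) (hvx : v ≠ x) (hvy : v ≠ y)
    (hxy : x ≠ y) (e : c u x = c u y) (e' : c v x = c v y) : False :=
  h.not_covered hu hv hx hy huv hux huy hvx hvy hxy j (c u v) (c u x) (c v x) (c x y)
    (by simp [← e', ← e])

theorem no_star (h : IsSpread N j c) {u x y z} (hu : u ∈ N) (hx : x ∈ N) (hy : y ∈ N)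
    (hz : z ∈ N) (hux : u ≠ x) (huy : u ≠ y) (huz : u ≠ z) (hxy : x ≠ y) (hxz : x ≠ z)
    (hyz : y ≠ z) (e : c u x = c u y) (e' : c u x = c u z) : False :=
  h.not_covered hu hx hy hz hux huy huz hxy hxz hyz j (c u x) (c x y) (c x z) (c y z)
    (by simp [← e', ← e])

/-- Adjacent vertices are not both centres of cherries of the same colour. -/
theorem no_path (h : IsSpread N j c) {u v x y} (hu : u ∈ N) (hv : v ∈ N) (hx : x ∈ N)
    (hy : y ∈ N) (huv : u ≠ v) (hux : u ≠ x) (huy : u ≠ y) (hvx : v ≠ x) (hvy : v ≠ y)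
    (e : c u v = c u x) (e' : c v u = c v y) : False := by
  by_cases hxy : x = y
  · subst hxy
    exact (h.base_ne hu hv hx huv hux hvx e).1 (by rw [← e', h.symm])
  · exact h.not_covered hu hv hx hy huv hux huy hvx hvy hxy j (c u v) (c u y) (c v x) (c x y)
      (by simp [← e', ← e, h.symm v u])

/-- At most one pair has colour `j`. -/
theorem card_filter_eq_le (h : IsSpread N j c) :
    (N.offDiag.filter fun p => c p.1 p.2 = j).card ≤ 2 := by
  by_contra hc
  obtain ⟨⟨x, y⟩, hp⟩ := Finset.card_pos.1 (by omega : 0 <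
    (N.offDiag.filter fun p => c p.1 p.2 = j).card)
  obtain ⟨⟨z, w⟩, hq, hq'⟩ := Finset.exists_mem_notMem_of_card_lt_card
    (show ({(x, y), (y, x)} : Finset (V × V)).card < _ from
      Finset.card_le_two.trans_lt (not_le.1 hc))
  simp only [Finset.mem_filter, Finset.mem_offDiag, Finset.mem_insert, Finset.mem_singleton,
    Prod.mk.injEq, not_or, not_and] at hp hq hq'
  obtain ⟨⟨hx, hy, hxy⟩, e⟩ := hp
  obtain ⟨⟨hz, hw, hzw⟩, e'⟩ := hq
  have two {a b d} (ha : a ∈ N) (hb : b ∈ N) (hd : d ∈ N) (hab : a ≠ b) (had : a ≠ d) (hbd : b ≠ d)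
      (e : c a b = j) (e' : c a d = j) : False := by
    obtain ⟨z, hz, haz, hbz, hdz⟩ := h.exists_fourth a b d
    exact h.not_covered ha hb hd hz hab had haz hbd hbz hdz j (c a z) (c b d) (c b z) (c d z)
      (by simp [e, e'])
  have s := h.symm
  by_cases h1 : x = z
  · subst h1
    exact two hx hy hw hxy hzw (fun e => hq'.1 rfl e.symm) e e'
  by_cases h2 : x = w
  · subst h2
    exact two hx hy hz hxy h1 (fun e => hq'.2 e.symm rfl) e (by rw [s, e'])
  by_cases h3 : y = z
  · subst h3
    exact two hy hx hw hxy.symm hzw h2 (by rw [s, e]) e'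
  by_cases h4 : y = w
  · subst h4
    exact two hy hx hz hxy.symm h3 h1 (by rw [s, e]) (by rw [s, e'])
  exact h.not_covered hx hy hz hw hxy h1 h2 h3 h4 hzw j (c x z) (c x w) (c y z) (c y w)
      (by simp [e, e'])

/-- The relation between a cherry, given by centre and colour, and the five pairs of a vertex and
a colour that it accounts for. -/
def Covers (N : Finset V) (c : V → V → K) (a b : V × K) : Prop :=
  (b.2 = a.2 ∧ (b.1 = a.1 ∨ a.1 ≠ b.1 ∧ c a.1 b.1 = a.2)) ∨
    (a.1 ≠ b.1 ∧ c a.1 b.1 = a.2 ∧ ∃ y ∈ N, y ≠ b.1 ∧ y ≠ a.1 ∧ c a.1 y = a.2 ∧ c b.1 y = b.2)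

/-- The centre and colour of a cherry in a colour other than `j`. -/
def IsCherry (N : Finset V) (j : K) (c : V → V → K) (a : V × K) : Prop :=
  a.1 ∈ N ∧ a.2 ≠ j ∧ ∃ x ∈ N, ∃ y ∈ N, a.1 ≠ x ∧ a.1 ≠ y ∧ x ≠ y ∧ c a.1 x = a.2 ∧ c a.1 y = a.2

/-- A vertex and the colour, other than `j`, of a pair that contains it. -/
def IsIncident (N : Finset V) (j : K) (c : V → V → K) (a : V × K) : Prop :=
  a.1 ∈ N ∧ a.2 ≠ j ∧ ∃ x ∈ N, a.1 ≠ x ∧ c a.1 x = a.2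

/-- A vertex of a cherry has its colour on no base of a cherry. -/
theorem covers_ne (h : IsSpread N j c) {u v w y : V} {i k : K} (hw : w ∈ N)
    (hu : IsCherry N j c (u, i))
    (hwu : w = u ∨ u ≠ w ∧ c u w = i) (hv : v ∈ N) (hvw : v ≠ w) (evw : c v w = k) (hy : y ∈ N)
    (hyw : y ≠ w) (hyv : y ≠ v) (evy : c v y = k) (ewy : c w y = i) : False := by
  obtain ⟨hu, -, x, hx, x', hx', hux, hux', hxx', e, e'⟩ := hu
  dsimp only at *
  have s := h.symm
  have iso {z} (hz : z ∈ N) (hwz : w ≠ z) (hyz : y ≠ z) (e : c w z = i) : False :=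
    h.base_isolated hv hw hy hz hvw hyv.symm hyw.symm hwz hyz (evw.trans evy.symm)
      (ewy.trans e.symm)
  have iso' {z} (hz : z ∈ N) (hwz : w ≠ z) (hyz : y ≠ z) (e : c y z = i) : False :=
    h.base_isolated hv hy hw hz hyv.symm hvw hyw hyz hwz (evy.trans evw.symm)
      ((s y w).trans (ewy.trans e.symm))
  rcases hwu with rfl | ⟨huw, ew⟩
  · by_cases hyx : y = x
    · subst hyx
      exact iso hx' hux' hxx' e'
    · exact iso hx hux hyx e
  · by_cases hyu : y = u
    · subst hyu
      by_cases hwx : w = x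
      · subst hwx
        exact iso' hx' hxx' hux' e'
      · exact iso' hx hwx hux e
    · exact iso hu huw.symm hyu (by rw [s, ew])

/-- If both cherries cover `b` through their own colour, distinct centres would produce two adjacent
centres of one colour, against `no_path`; when `b.1` is an end of both, it is itself such a centre.
The mixed case is `covers_ne`. If both cover it through their bases, `base_isolated` makes the bases
equal and `base_unique` the centres. -/
theorem covers_unique (h : IsSpread N j c) {a a' b : V × K} (ha : IsCherry N j c a)
    (ha' : IsCherry N j c a') (hb : b.1 ∈ N) (hab : Covers N c a b) (hab' : Covers N c a' b) :
    a = a' := by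
  obtain ⟨u, i⟩ := a
  obtain ⟨u', i'⟩ := a'
  obtain ⟨w, k⟩ := b
  have s := h.symm
  rcases hab with ⟨h1, h2⟩ | ⟨h1, h2, y, hy, h3, h4, h5, h6⟩ <;>
    rcases hab' with ⟨g1, g2⟩ | ⟨g1, g2, y', hy', g3, g4, g5, g6⟩ <;> dsimp only at *
  · subst h1 g1
    by_contra hne
    have huu : u ≠ u' := fun e => hne (by rw [e])
    have path {v v' : V} {i : K} (hv : IsCherry N j c (v, i)) (hv' : IsCherry N j c (v', i))
        (hvv : v ≠ v') (e : c v v' = i) : False := by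
      obtain ⟨hv, -, x, hx, x', hx', hux, hux', hxx', e1, e1'⟩ := hv
      obtain ⟨hv', -, z, hz, z', hz', huz, huz', hzz', e2, e2'⟩ := hv'
      dsimp only at *
      have p1 : ∃ x ∈ N, v' ≠ x ∧ v ≠ x ∧ c v x = i := by
        by_cases hx1 : v' = x
        · exact ⟨x', hx', hx1 ▸ hxx', hux', e1'⟩
        · exact ⟨x, hx, hx1, hux, e1⟩
      have p2 : ∃ x ∈ N, v ≠ x ∧ v' ≠ x ∧ c v' x = i := by
        by_cases hx1 : v = z
        · exact ⟨z', hz', hx1 ▸ hzz', huz', e2'⟩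
        · exact ⟨z, hz, hx1, huz, e2⟩
      obtain ⟨x, hx, n1, n2, n3⟩ := p1
      obtain ⟨z, hz, m1, m2, m3⟩ := p2
      exact h.no_path hv hv' hx hz hvv n2 m1 n1 m2 (e.trans n3.symm)
        ((s _ _).trans (e.trans m3.symm))
    rcases h2 with rfl | ⟨n1, n2⟩
    · rcases g2 with rfl | ⟨m1, m2⟩
      · exact huu rfl
      · exact path ha' ha m1 m2
    · rcases g2 with rfl | ⟨m1, m2⟩
      · exact path ha ha' n1 n2
      · have hw : IsCherry N j c (w, k) :=
          ⟨hb, ha.2.1, u, ha.1, u', ha'.1, n1.symm, m1.symm, huu, by rw [s, n2], by rw [s, m2]⟩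
        exact path ha hw n1 n2
  · subst h1
    exact (h.covers_ne hb ha h2 ha'.1 g1 g2 hy' g3 g4 g5 g6).elim
  · subst g1
    exact (h.covers_ne hb ha' g2 ha.1 h1 h2 hy h3 h4 h5 h6).elim
  · have hyy : y = y' := by
      by_contra hyy
      exact h.base_isolated ha.1 hb hy hy' h1 h4.symm h3.symm g3.symm hyy (h2.trans h5.symm)
        (h6.trans g6.symm)
    subst hyy
    have huu : u = u' := by
      by_contra huu
      exact h.base_unique ha.1 ha'.1 hb hy huu h1 h4.symm g1 g4.symm h3.symm (h2.trans h5.symm)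
        (g2.trans g5.symm)
    subst huu
    rw [← h2, ← g2]

-- Double counting of `Covers`: each cherry covers five incidences, and each incidence is covered by
-- at most one cherry.
open Classical in
theorem five_mul_card_cherry_le (h : IsSpread N j c) [Fintype K] :
    ((N ×ˢ Finset.univ).filter (IsCherry N j c)).card * 5 ≤
      ((N ×ˢ Finset.univ).filter (IsIncident N j c)).card := by
  have := Finset.card_mul_le_card_mul (Covers N c) (m := 5) (n := 1)
    (s := (N ×ˢ Finset.univ).filter (IsCherry N j c))
    (t := (N ×ˢ Finset.univ).filter (IsIncident N j c)) ?_ ?_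
  · simpa using this
  · rintro ⟨u, i⟩ ha
    obtain ⟨-, hu, hi, x, hx, y, hy, hux, huy, hxy, e, e'⟩ := Finset.mem_filter.1 ha
    dsimp only at *
    have s := h.symm
    obtain ⟨n1, n2⟩ := h.base_ne hu hx hy hux huy hxy (e.trans e'.symm)
    rw [e] at n1
    have hc : ([(u, i), (x, i), (y, i), (x, c x y), (y, c x y)].toFinset).card = 5 :=
      List.toFinset_card_of_nodup (by simp [hux, huy, hxy, n1.symm])
    rw [← hc]
    refine Finset.card_le_card fun b hb => ?_
    simp only [List.mem_toFinset, List.mem_cons, List.not_mem_nil, or_false] at hb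
    simp only [Finset.bipartiteAbove, Finset.mem_filter, Finset.mem_product, Finset.mem_univ,
      and_true]
    rcases hb with rfl | rfl | rfl | rfl | rfl
    · exact ⟨⟨hu, hu, hi, x, hx, hux, e⟩, .inl ⟨rfl, .inl rfl⟩⟩
    · exact ⟨⟨hx, hx, hi, u, hu, hux.symm, (s _ _).trans e⟩, .inl ⟨rfl, .inr ⟨hux, e⟩⟩⟩
    · exact ⟨⟨hy, hy, hi, u, hu, huy.symm, (s _ _).trans e'⟩, .inl ⟨rfl, .inr ⟨huy, e'⟩⟩⟩
    · exact ⟨⟨hx, hx, n2, y, hy, hxy, rfl⟩, .inr ⟨hux, e, y, hy, hxy.symm, huy.symm, e', rfl⟩⟩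
    · exact ⟨⟨hy, hy, n2, x, hx, hxy.symm, s _ _⟩, .inr ⟨huy, e', x, hx, hxy, hux.symm, e, s _ _⟩⟩
  · intro b hb
    refine Finset.card_le_one.2 fun a ha a' ha' => ?_
    simp only [Finset.bipartiteBelow, Finset.mem_filter] at ha ha' hb
    exact h.covers_unique ha.1.2 ha'.1.2 hb.2.1 ha.2 ha'.2

-- Sending an ordered pair to its first vertex and its colour has fibres of size at most two by
-- `no_star`, and a fibre of size two is a cherry.
open Classical in
theorem card_filter_ne_le (h : IsSpread N j c) [Fintype K] :
    (N.offDiag.filter fun p => ¬ c p.1 p.2 = j).card ≤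
      ((N ×ˢ Finset.univ).filter (IsIncident N j c)).card +
        ((N ×ˢ Finset.univ).filter (IsCherry N j c)).card := by
  rw [Finset.card_eq_sum_card_fiberwise (f := fun p : V × V => (p.1, c p.1 p.2))
    (t := (N ×ˢ Finset.univ).filter (IsIncident N j c))]
  · have hsub : (N ×ˢ Finset.univ).filter (IsCherry N j c) =
        ((N ×ˢ Finset.univ).filter (IsIncident N j c)).filter (IsCherry N j c) := by
      ext a
      simp only [Finset.mem_filter]
      exact ⟨fun ⟨h1, h2⟩ => ⟨⟨h1, h2.1, h2.2.1, h2.2.2.choose, h2.2.2.choose_spec.1,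
        h2.2.2.choose_spec.2.choose_spec.2.1,
        h2.2.2.choose_spec.2.choose_spec.2.2.2.2.1⟩, h2⟩, fun ⟨h1, h2⟩ => ⟨h1.1, h2⟩⟩
    rw [hsub, Finset.card_eq_sum_ones, Finset.card_filter, ← Finset.sum_add_distrib]
    refine Finset.sum_le_sum fun a ha => ?_
    obtain ⟨w, i⟩ := a
    have hw := (Finset.mem_filter.1 ha).2.1
    have mem {p} (hp : p ∈ ({a ∈ N.offDiag.filter fun p => ¬ c p.1 p.2 = j |
        (a.1, c a.1 a.2) = (w, i)} : Finset (V × V))) :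
        p.1 = w ∧ p.2 ∈ N ∧ w ≠ p.2 ∧ c w p.2 = i := by
      simp only [Finset.mem_filter, Finset.mem_offDiag, Prod.mk.injEq] at hp
      obtain ⟨⟨⟨-, h1, h2⟩, -⟩, rfl, h3⟩ := hp
      exact ⟨rfl, h1, h2, h3⟩
    have ne {p q : V × V} (hp : p.1 = w) (hq : q.1 = w) (hpq : p ≠ q) : p.2 ≠ q.2 :=
      fun e => hpq (Prod.ext (hp.trans hq.symm) e)
    have two_le := Nat.lt_add_one_iff.1 (not_le.1 fun hc : 2 < Finset.card _ => by
      obtain ⟨p, q, r, hp, hq, hr, hpq, hpr, hqr⟩ := Finset.two_lt_card_iff.1 hc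
      obtain ⟨p1, p2, p3, p4⟩ := mem hp
      obtain ⟨q1, q2, q3, q4⟩ := mem hq
      obtain ⟨r1, r2, r3, r4⟩ := mem hr
      exact h.no_star hw p2 q2 r2 p3 q3 r3 (ne p1 q1 hpq) (ne p1 r1 hpr) (ne q1 r1 hqr)
        (p4.trans q4.symm) (p4.trans r4.symm))
    split_ifs with hch
    · exact two_le
    · refine not_lt.1 fun hc => hch ?_
      obtain ⟨p, q, hp, hq, hpq⟩ := Finset.one_lt_card_iff.1 hc
      obtain ⟨p1, p2, p3, p4⟩ := mem hp
      obtain ⟨q1, q2, q3, q4⟩ := mem hq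
      exact ⟨hw, (Finset.mem_filter.1 ha).2.2.1, p.2, p2, q.2, q2, p3, q3, ne p1 q1 hpq, p4, q4⟩
  · rintro ⟨x, y⟩ hp
    simp only [Finset.coe_filter, Finset.mem_offDiag, Set.mem_ofPred_eq] at hp
    simp only [Finset.coe_filter, Finset.mem_product, Finset.mem_univ, and_true, Set.mem_ofPred_eq]
    exact ⟨hp.1.1, hp.1.1, hp.2, y, hp.1.2.1, hp.1.2.2, rfl⟩

open Classical in
theorem card_incident_le [Fintype K] :
    ((N ×ˢ Finset.univ).filter (IsIncident N j c)).card ≤ N.card * (Fintype.card K - 1) := by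
  rw [← Finset.card_univ, ← Finset.card_erase_of_mem (Finset.mem_univ j), ← Finset.card_product]
  refine Finset.card_le_card fun a ha => ?_
  obtain ⟨-, h1, h2, -⟩ := Finset.mem_filter.1 ha
  simp [h1, h2]

/-- With `I ≤ d (k - 1)` incidences, the ordered pairs number at most `2 + I + I / 5`, where the `2`
stands for the pairs of colour `j`; the inequality is multiplied by five. -/
theorem card_le (h : IsSpread N j c) [Fintype K] :
    5 * (N.card * (N.card - 1)) ≤ 6 * (N.card * (Fintype.card K - 1)) + 10 := by
  classical
  have h1 := h.card_filter_eq_le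
  have h2 := h.card_filter_ne_le
  have h3 := h.five_mul_card_cherry_le
  have h4 := card_incident_le (N := N) (j := j) (c := c)
  have h5 := Finset.card_filter_add_card_filter_not (s := N.offDiag) fun p => c p.1 p.2 = j
  rw [Finset.offDiag_card] at h5
  have h6 : N.card * (N.card - 1) = N.card * N.card - N.card := by rw [Nat.mul_sub, mul_one]
  omega

end IsSpread

end Counting

/-! ### The lower bound -/

theorem IsPQColoring.lower_bound {n k : ℕ} (hn : 100 ≤ n)
    {c : SimpleGraph.TopEdgeLabeling (Fin n) (Fin k)} (hc : IsPQColoring c 5 6) :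
    120 * n ≤ 144 * k ^ 2 + 95 := by
  classical
  have h01 : (⟨0, by omega⟩ : Fin n) ≠ ⟨1, by omega⟩ := by simp
  set v : Fin n := ⟨0, by omega⟩
  set k₀ : Fin k := c.get v ⟨1, by omega⟩ h01
  set f : Fin n → Fin n → Fin k := fun x y => if h : x ≠ y then c.get x y h else k₀ with hf
  have fget {x y} (h : x ≠ y) : c.get x y h = f x y := by simp [hf, h]
  have symm (x y) : f x y = f y x := by
    by_cases h : x = y
    · rw [h]
    · rw [← fget h, ← fget (Ne.symm h), SimpleGraph.EdgeLabeling.get_comm]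
  set N : Fin k → Finset (Fin n) := fun j => (Finset.univ.erase v).filter fun x => f v x = j
    with hN
  obtain ⟨j, -, hj⟩ := Finset.exists_max_image Finset.univ (fun j => (N j).card) ⟨k₀, by simp⟩
  have hsum : n - 1 ≤ k * (N j).card := by
    have h1 : (Finset.univ.erase v).card = n - 1 := by simp
    rw [← h1, Finset.card_eq_sum_card_fiberwise (f := f v) (t := Finset.univ) (by simp)]
    simpa using Finset.sum_le_card_nsmul Finset.univ (fun j => (N j).card) _ hj
  by_contra! hlt
  -- Eleven exceeds the additive `10` in `IsSpread.card_le`. A smaller `d` gives `n ≤ 10 k + 1`,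
  -- which `hlt` and `100 ≤ n` exclude.
  have hd : 11 ≤ (N j).card := by
    by_contra! hd
    have : n - 1 ≤ k * 10 := hsum.trans (Nat.mul_le_mul_left _ (by omega))
    have h2 : n ≤ 10 * k + 1 := by omega
    nlinarith
  have hmem {x} (hx : x ∈ N j) : v ≠ x ∧ f v x = j := by
    simp only [hN, Finset.mem_filter, Finset.mem_erase, Finset.mem_univ, and_true] at hx
    exact ⟨Ne.symm hx.1, hx.2⟩
  have hspread : IsSpread (N j) j f := by
    refine ⟨symm, ?_, by omega⟩
    intro u x y z hu hx hy hz hux huy huz hxy hxz hyz T j0 j1 j2 j3 j4 j5 j6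
    obtain ⟨vu, eu⟩ := hmem hu
    obtain ⟨vx, ex⟩ := hmem hx
    obtain ⟨vy, ey⟩ := hmem hy
    obtain ⟨vz, ez⟩ := hmem hz
    have h5 : ([v, u, x, y, z].toFinset).card = 5 := List.toFinset_card_of_nodup
      (by simp [vu, vx, vy, vz, hux, huy, huz, hxy, hxz, hyz])
    have h6 := hc _ h5
    rw [← Set.ncard_coe_finset]
    refine h6.trans (Set.ncard_le_ncard ?_ (Finset.finite_toSet _))
    rintro _ ⟨a, ha, b, hb, hab, rfl⟩
    simp only [List.mem_toFinset, List.mem_cons, List.not_mem_nil, or_false] at ha hb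
    have hab' : a ≠ b := hab
    rw [fget hab', Finset.mem_coe]
    rcases ha with rfl | rfl | rfl | rfl | rfl <;> rcases hb with rfl | rfl | rfl | rfl | rfl <;>
      first
      | exact (hab' rfl).elim
      | assumption
      | (rw [symm]; assumption)
      | (simp only [eu, ex, ey, ez]; assumption)
      | (rw [symm]; simp only [eu, ex, ey, ez]; assumption)
  have hcard := hspread.card_le
  rw [Fintype.card_fin] at hcard
  set d := (N j).card
  have hk : 1 ≤ k := by have := j.2; omega
  obtain ⟨e, he⟩ : ∃ e, d = e + 1 := ⟨d - 1, by omega⟩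
  obtain ⟨l, hl⟩ : ∃ l, k = l + 1 := ⟨k - 1, by omega⟩
  -- Otherwise `5 d ≤ 6 k - 1`, so `n ≤ k d + 1` gives `120 n ≤ 144 k² - 24 k + 120`, which is at
  -- most `144 k² + 95` once `k ≥ 2`.
  have h6 : 6 * k ≤ 5 * d := by
    by_contra! h6
    have h7 : n ≤ k * d + 1 := by omega
    have h8 : k * (5 * d + 1) ≤ k * (6 * k) := Nat.mul_le_mul_left _ h6
    have h9 : 2 ≤ k := by
      by_contra! h9
      have : k = 1 := by omega
      omega
    nlinarith
  rw [he, hl] at hcard h6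
  simp only [Nat.add_sub_cancel] at hcard
  rw [he] at hd
  nlinarith


/-- The infimum defining `erdosGyarfas` is attained only over a nonempty set (`sInf ∅ = 0` in `ℕ`);
the rainbow colouring, with ten colours on five points, provides a member. -/
theorem exists_isPQColoring (n : ℕ) :
    ∃ k, ∃ c : SimpleGraph.TopEdgeLabeling (Fin n) (Fin k), IsPQColoring c 5 6 := by
  classical
  obtain ⟨k, ⟨g⟩⟩ := Finite.exists_equiv_fin (Sym2 (Fin n))
  refine ⟨k, .mk (fun x y _ => g s(x, y)) fun x y _ => by rw [Sym2.eq_swap], fun S hS => ?_⟩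
  have h1 : 6 ≤ ((S.offDiag.image fun p => g s(p.1, p.2) : Finset (Fin k))).card := by
    have h2 : (S.offDiag.image fun p => g s(p.1, p.2)) =
        (S.offDiag.image Sym2.mk.uncurry).image g := by
      rw [Finset.image_image]; rfl
    rw [h2, Finset.card_image_of_injective _ g.injective, Sym2.card_image_offDiag, hS]
    decide
  refine h1.trans ?_
  rw [← Set.ncard_coe_finset]
  refine Set.ncard_le_ncard ?_ (Set.toFinite _)
  intro a ha
  simp only [Finset.coe_image, Set.mem_image, Finset.mem_coe, Finset.mem_offDiag] at ha
  obtain ⟨⟨x, y⟩, ⟨hx, hy, hxy⟩, rfl⟩ := ha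
  exact ⟨x, hx, y, hy, hxy, rfl⟩

theorem sqrt_le_erdosGyarfas {n : ℕ} (hn : 100 ≤ n) :
    Real.sqrt (5 / 6 * (n : ℝ) - 95 / 144) ≤ (erdosGyarfas n 5 6 : ℝ) := by
  obtain ⟨c, hc⟩ := Nat.sInf_mem (exists_isPQColoring n)
  have h := hc.lower_bound hn
  change 120 * n ≤ 144 * erdosGyarfas n 5 6 ^ 2 + 95 at h
  have h' : (120 * n : ℝ) ≤ 144 * (erdosGyarfas n 5 6 : ℝ) ^ 2 + 95 := by exact_mod_cast h
  exact Real.sqrt_le_iff.2 ⟨by positivity, by linarith⟩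

/-! ### Choice of parameters and the asymptotic upper bound -/

theorem erdosGyarfas_le_rpow {n : ℕ} (hn : 1 ≤ n) (h4 : 4 ≤ Real.sqrt (Real.log n)) :
    (erdosGyarfas n 5 6 : ℝ) ≤ (n : ℝ) ^ (1 / 2 : ℝ) *
      (2 : ℝ) ^ (9 / (2 * Real.log 2) * (Real.sqrt (Real.log n) * Real.log (Real.log n))) := by
  set X := Real.sqrt (Real.log n) with hX
  have hlog : Real.log n = X ^ 2 := by
    refine (Real.sq_sqrt ?_).symm
    by_contra! h
    rw [hX, Real.sqrt_eq_zero_of_nonpos h.le] at h4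
    norm_num at h4
  have hn' : (1 : ℝ) ≤ n := by exact_mod_cast hn
  have hs : 1 ≤ Nat.sqrt n := Nat.le_sqrt.2 (by omega)
  -- Bertrand's postulate above `Nat.sqrt n + 1 ≥ 2` yields a prime that is odd, has `n ≤ p ^ 2`,
  -- and is at most `4 √n`.
  obtain ⟨p, hp, hlt, hle⟩ := Nat.exists_prime_lt_and_le_two_mul (Nat.sqrt n + 1) (by omega)
  have : Fact p.Prime := ⟨hp⟩
  have hnp : n ≤ p ^ 2 := by
    have := Nat.lt_succ_sqrt n
    nlinarith
  have hsq : (Nat.sqrt n : ℝ) ≤ Real.sqrt n := Real.nat_sqrt_le_real_sqrt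
  have h1n : 1 ≤ Real.sqrt n := Real.one_le_sqrt.2 hn'
  have hp4 : (p : ℝ) ≤ 4 * Real.sqrt n := by
    have : (p : ℝ) ≤ 2 * (Nat.sqrt n + 1) := by exact_mod_cast hle
    linarith
  -- With `b = T`, the words have length `T² ≥ 4 log n`, enough to separate `p² ≤ 16 n` points.
  set T := ⌈2 * X⌉₊ with hT
  have hT1 : 2 * X ≤ T := Nat.le_ceil _
  have hT2 : (T : ℝ) < 2 * X + 1 := Nat.ceil_lt_add_one (by linarith)
  have hb : p ^ 2 ≤ 2 ^ (T * T) := by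
    have : (p : ℝ) ^ 2 ≤ 2 ^ (T * T) := by
      have h16 : (p : ℝ) ^ 2 ≤ 2 ^ 4 * (n : ℝ) := by
        calc (p : ℝ) ^ 2 ≤ (4 * Real.sqrt n) ^ 2 := by gcongr
          _ = 2 ^ 4 * (n : ℝ) := by rw [mul_pow, Real.sq_sqrt (by linarith)]; norm_num
      refine h16.trans ?_
      rw [← Real.log_le_log_iff (by positivity) (by positivity), Real.log_mul (by norm_num)
        (by linarith), Real.log_pow, Real.log_pow, hlog]
      have h2 := Real.log_two_gt_d9
      have h3 := Real.log_two_lt_d9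
      have h5 : (2 * X) * (2 * X) ≤ (T : ℝ) * T := by gcongr
      push_cast
      nlinarith
    exact_mod_cast this
  have key := erdosGyarfas_five_six_le (n := n) (p := p) (T := T) (b := T) (by omega) hnp hb
  have key' : (erdosGyarfas n 5 6 : ℝ) ≤
      (T * T + 1) * ((T + 1) ^ T * (2 ^ T * (2 ^ T * (p * 4)))) := by exact_mod_cast key
  -- Since `X ≥ 4`, every factor besides `√n` is at most a power of `X`, with total exponent `4 + 2
  -- T + T + 2 = 3 T + 6 ≤ 9 X`.
  have hTX : (T : ℝ) + 1 ≤ X ^ 2 := by nlinarith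
  have hTT : (T : ℝ) * T + 1 ≤ (X ^ 2) ^ 2 := by nlinarith [Nat.cast_nonneg (α := ℝ) T]
  have hpX : (p : ℝ) * 4 ≤ Real.sqrt n * X ^ 2 := by
    have h16 : (16 : ℝ) ≤ X ^ 2 := by nlinarith
    calc (p : ℝ) * 4 ≤ Real.sqrt n * 16 := by linarith
      _ ≤ Real.sqrt n * X ^ 2 := by gcongr
  have h4T : (2 : ℝ) ^ T * 2 ^ T ≤ X ^ T := by
    rw [← mul_pow]
    gcongr
    linarith
  calc (erdosGyarfas n 5 6 : ℝ)
      ≤ (T * T + 1) * ((T + 1) ^ T * (2 ^ T * (2 ^ T * (p * 4)))) := key'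
    _ = (T * T + 1) * (T + 1) ^ T * (2 ^ T * 2 ^ T) * (p * 4) := by ring
    _ ≤ (X ^ 2) ^ 2 * (X ^ 2) ^ T * X ^ T * (Real.sqrt n * X ^ 2) := by
      gcongr
    _ = Real.sqrt n * X ^ (3 * T + 6) := by ring
    _ ≤ _ := by
      rw [← Real.sqrt_eq_rpow]
      gcongr
      have hX0 : 0 < X := by linarith
      have hlX : 0 ≤ Real.log X := Real.log_nonneg (by linarith)
      rw [Real.rpow_def_of_pos (by norm_num), ← Real.rpow_natCast, Real.rpow_def_of_pos hX0, hlog,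
        Real.log_pow]
      refine Real.exp_le_exp.2 ?_
      have h2 : Real.log 2 ≠ 0 := (Real.log_pos (by norm_num)).ne'
      -- As `log (log n) = 2 log X`, the constant `9 / (2 log 2)` makes the power of two equal to `X
      -- ^ (9 X)`.
      have : Real.log 2 * (9 / (2 * Real.log 2) * (X * ((2 : ℕ) * Real.log X))) =
          Real.log X * (9 * X) := by
        field_simp
        push_cast
        ring
      rw [this]
      gcongr
      push_cast
      linarith

theorem theorem1 :
    (∀ᶠ n : ℕ in Filter.atTop,
      Real.sqrt (5 / 6 * (n : ℝ) - 95 / 144) ≤ (erdosGyarfas n 5 6 : ℝ)) ∧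
    (∃ C : ℝ, ∀ᶠ n : ℕ in Filter.atTop,
      (erdosGyarfas n 5 6 : ℝ) ≤
        (n : ℝ) ^ (1 / 2 : ℝ) *
          (2 : ℝ) ^ (C * (Real.sqrt (Real.log n) * Real.log (Real.log n)))) := by
  refine ⟨?_, 9 / (2 * Real.log 2), ?_⟩
  · filter_upwards [Filter.eventually_ge_atTop 100] with n hn using sqrt_le_erdosGyarfas hn
  · have h := (Real.tendsto_sqrt_atTop.comp
      (Real.tendsto_log_atTop.comp tendsto_natCast_atTop_atTop)).eventually_ge_atTop 4
    filter_upwards [h, Filter.eventually_ge_atTop 1] with n h4 hn using erdosGyarfas_le_rpow hn h4
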